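/- **Setting.** Let $n\ge 2$, $k\ge 1$. A bandit instance with (non-separator) post-action context consists of a known matrix $A\in\mathbb R^{k\times n}$ with strictly positive entries and columns summing to $1$, $A_{j,i}=\mathbb P(Z=j\mid X=i)$, and an unknown matrix $\mu\in\mathbb R^{k\times n}$. Pulling arm $X=i$ yields a context $Z\in[k]$ with law $A_i$ and then, given $Z=j$, a reward $Y\sim\mathcal N(\mu_{j,i},1)$, independently of the past. Let $\mathcal I=\mathcal I(A)$ be the set of $\mu$ for which $i^*(\mu)=\operatorname{argmax}_i A_i^\top\mu_i$ is unique, and for $\mu\in\mathcal I$ put $\Delta_i=A_{i^*(\mu)}^\top\mu_{i^*(\mu)}-A_i^\top\mu_i$, $\mathrm{Alt}(\mu,A)=\{\mu'\in\mathcal I: i^*(\mu')\ne i^*(\mu)\}$, $$T^*(\mu,A)^{-1}=\sup_{w\in\Delta^{n-1}}\min_{i\ne i^*(\mu)}\frac{\Delta_i^2}{2}\,\frac{w_{i^*(\mu)}w_i}{w_{i^*(\mu)}+w_i}$$ (with $0/0=0$), and let $w^*(\mu,A)$ be the maximizer over the simplex $\Delta^{n-1}$. After $t$ rounds let $N_i(t)$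 and $N_{j,i}(t)$ be the numbers of pulls of arm $i$ and of observations of the pair (arm $i$, context $j$), and $\hat\mu(t)$ the matrix of empirical means. **Algorithm (NSTS).** *Initialization:* pull arms until every pair $(i,j)$ has been observed at least once, in any order (possibly random and history-dependent) such that for some $M\in\mathbb N$, $c>0$: if, during initialization, none of the last $M$ pulls was of an arm with a context not yet observed, then the next pull is of such an arm with conditional probability at least $c$. *Sampling:* after initialization, if $\hat\mu(t)\notin\mathcal I$ the next arm is uniformly random; otherwise, with $\mathcal U_t=\{i: N_i(t)\le\max(\sqrt t-n/2,0)\}$, the next arm is in $\operatorname{argmin}_{i\in\mathcal U_t}N_i(t)$ if $\mathcal U_t\ne\emptyset$ and in $\operatorname{argmax}_{i}\,\bigl(t\,w_i^*(\hat\mu(t),A)-N_i(t)\bigr)$ if $\mathcal U_t=\emptyset$, ties being broken arbitrarily. *Stopping:* for $\delta\in(0,1)$, $\tau_\delta$ is the first $t$, from the end of the initialization on, with $\Lambda(t)>\hat c_t(\delta)$ ($\tau_\delta=\infty$ if there is none), where $$\Lambda(t)=\inf_{\mu'\in\mathrm{Alt}(\hat\mu(t),A)}\sum_{i,j}N_{j,i}(t)\frac{(\hat\mu_{j,i}(t)-\mu'_{j,i})^2}{2}\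 \text{ if }\hat\mu(t)\in\mathcal I,\qquad \Lambda(t)=0\text{ otherwise},$$ $$\hat c_t(\delta)=4k\ln\Bigl(4+\ln\frac{t}{2k}\Bigr)+2k\,C^g\Bigl(\frac{\ln((n-1)/\delta)}{2k}\Bigr),\qquad C^g(x)=\min_{\lambda\in(1/2,1]}\frac{g(\lambda)+x}{\lambda},$$ $g(\lambda)=2\lambda-2\lambda\ln(4\lambda)+\ln\zeta(2\lambda)-\tfrac12\ln(1-\lambda)$, $g(1)=+\infty$. **Theorem (Non-Separator Upper Bound).** For every such $A$, every $\mu\in\mathcal I(A)$ and every version of NSTS, $\tau_\delta$ is a random variable (measurable) for each $\delta\in(0,1)$, and $$\limsup_{\delta\to0}\frac{\mathbb E_{\mu,A}[\tau_\delta]}{\ln(1/\delta)}\le T^*(\mu,A).$$ Hence NSTS asymptotically matches the non-separator lower bound $T^*(\mu,A)\,d_B(\delta,1-\delta)$, that is, $$\limsup_{\delta\to0}\frac{\mathbb E_{\mu,A}[\tau_\delta]}{T^*(\mu,A)\,d_B(\delta,1-\delta)}\le1,$$ where $d_B(p,q)=p\ln\frac pq+(1-p)\ln\frac{1-p}{1-q}$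 is the Kullback–Leibler divergence of Bernoulli laws. -/

import Mathlib

open Filter Topology MeasureTheory ProbabilityTheory
open scoped ENNReal

noncomputable section

namespace PostActionBAI

/-! ### Instances -/

/-- A context probability matrix `A` for `n` arms and `k` contexts, `A j i = ℙ(Z = j | X = i)`:
every column is a probability vector with strictly positive entries. -/
structure ContextMatrix (n k : ℕ) where
  prob : Matrix (Fin k) (Fin n) ℝ
  pos : ∀ j i, 0 < prob j i
  sum_eq_one : ∀ i, ∑ j, prob j i = 1

variable {n k : ℕ}

/-- The expected reward `A_iᵀ μ_i` of arm `i`. -/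
def armMean (A μ : Matrix (Fin k) (Fin n) ℝ) (i : Fin n) : ℝ := ∑ j, A j i * μ j i

/-- Arm `i` is the unique arm with the largest expected reward. -/
def IsBestArm (A μ : Matrix (Fin k) (Fin n) ℝ) (i : Fin n) : Prop :=
  ∀ i', i' ≠ i → armMean A μ i' < armMean A μ i

/-- The set `𝓘(A)` of mean matrices with a unique best arm. -/
def uniqueBest (A : Matrix (Fin k) (Fin n) ℝ) : Set (Matrix (Fin k) (Fin n) ℝ) :=
  {μ | ∃ i, IsBestArm A μ i}

/-- The best arm `i*(μ, A)`; meaningful for `μ ∈ 𝓘(A)`. -/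
def bestArm [NeZero n] (A μ : Matrix (Fin k) (Fin n) ℝ) : Fin n :=
  Classical.epsilon (IsBestArm A μ)

/-- The sub-optimality gap `Δ_i`. -/
def gap [NeZero n] (A μ : Matrix (Fin k) (Fin n) ℝ) (i : Fin n) : ℝ :=
  armMean A μ (bestArm A μ) - armMean A μ i

/-- The alternatives to `μ`: mean matrices with a unique best arm, different from that of `μ`. -/
def alt [NeZero n] (A μ : Matrix (Fin k) (Fin n) ℝ) : Set (Matrix (Fin k) (Fin n) ℝ) :=
  {μ' | μ' ∈ uniqueBest A ∧ bestArm A μ' ≠ bestArm A μ}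

/-- The objective `min_{i ≠ i*} (Δ_i² / 2) * (w_{i*} w_i / (w_{i*} + w_i))`. The quotient is `0`
when both weights vanish, which is its continuous extension. -/
def objective [NeZero n] (A μ : Matrix (Fin k) (Fin n) ℝ) (w : Fin n → ℝ) : ℝ :=
  ⨅ i : {i : Fin n // i ≠ bestArm A μ},
    gap A μ i ^ 2 / 2 * (w (bestArm A μ) * w i / (w (bestArm A μ) + w i))

/-- The characteristic time `T*(μ, A)`, the inverse of the largest value of the objective on the
simplex. -/
def charTime [NeZero n] (A μ : Matrix (Fin k) (Fin n) ℝ) : ℝ :=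
  (⨆ w : stdSimplex ℝ (Fin n), objective A μ w)⁻¹

/-- The optimal weights `w*(μ, A)`, the maximizer of the objective over the simplex. -/
def optWeights [NeZero n] (A μ : Matrix (Fin k) (Fin n) ℝ) : Fin n → ℝ :=
  Classical.epsilon fun w ↦
    w ∈ stdSimplex ℝ (Fin n) ∧ IsMaxOn (objective A μ) (stdSimplex ℝ (Fin n)) w

/-! ### Histories and the statistics computed from them -/

/-- What happens in one round: the arm pulled, the context and the reward observed. -/
abbrev Round (n k : ℕ) : Type := Fin n × Fin k × ℝ

/-- The history of the first `t` rounds. -/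
abbrev History (n k t : ℕ) : Type := Fin t → Round n k

variable {t : ℕ}

/-- `N^X_i(t)`, the number of pulls of arm `i`. -/
def armCount (h : History n k t) (i : Fin n) : ℕ :=
  (Finset.univ.filter fun s ↦ (h s).1 = i).card

/-- `N_{j,i}(t)`, the number of rounds in which arm `i` was pulled and context `j` observed. -/
def pairCount (h : History n k t) (j : Fin k) (i : Fin n) : ℕ :=
  (Finset.univ.filter fun s ↦ (h s).1 = i ∧ (h s).2.1 = j).card

/-- The matrix `μ̂(t)` of empirical means (an entry without a sample is `0`). -/
def empMean (h : History n k t) : Matrix (Fin k) (Fin n) ℝ := fun j i ↦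
  (∑ s ∈ Finset.univ.filter (fun s ↦ (h s).1 = i ∧ (h s).2.1 = j), (h s).2.2) / pairCount h j i

/-- The arms some of whose contexts have not been observed yet. -/
def incompleteArms (h : History n k t) : Set (Fin n) := {i | ∃ j, pairCount h j i = 0}

/-- The initialization phase is over: each arm-context pair has been sampled. -/
def Initialized (h : History n k t) : Prop := ∀ j i, 0 < pairCount h j i

/-! ### Stopping rule -/

open Classical in
/-- The generalized likelihood ratio statistic `Λ(t)`. -/
def glr [NeZero n] (A : Matrix (Fin k) (Fin n) ℝ) (h : History n k t) : ℝ :=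
  if empMean h ∈ uniqueBest A then
    ⨅ μ' : alt A (empMean h),
      ∑ i, ∑ j, pairCount h j i * ((empMean h j i - (μ' : Matrix (Fin k) (Fin n) ℝ) j i) ^ 2 / 2)
  else 0

/-- The function `g(x) = 2x - 2x ln(4x) + ln ζ(2x) - ln(1 - x) / 2` for `1/2 < x < 1`. -/
def gFun (x : ℝ) : ℝ :=
  2 * x - 2 * x * Real.log (4 * x) + Real.log (∑' m : ℕ, 1 / ((m : ℝ) + 1) ^ (2 * x))
    - 1 / 2 * Real.log (1 - x)

/-- `C^g(x) = min_{1/2 < l ≤ 1} (g(l) + x) / l`. Since `g(1) = +∞`, the endpoint `1` is left out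
of the range of `l`. -/
def Cg (x : ℝ) : ℝ := sInf ((fun l : ℝ ↦ (gFun l + x) / l) '' Set.Ioo (1 / 2) 1)

/-- The sequential threshold `ĉ_t(δ)`. -/
def threshold (n k t : ℕ) (δ : ℝ) : ℝ :=
  4 * k * Real.log (4 + Real.log (t / (2 * k)))
    + 2 * k * Cg (Real.log (((n : ℝ) - 1) / δ) / (2 * k))

/-- The first `t` rounds of an infinite trajectory. -/
def trunc (ω : ℕ → Round n k) (t : ℕ) : History n k t := fun s ↦ ω s

/-- The stopping time `τ_δ`: the first `t`, from the end of the initialization on, at which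
`Λ(t) > ĉ_t(δ)`; it is `⊤` if there is none. -/
def stopTime [NeZero n] (A : Matrix (Fin k) (Fin n) ℝ) (δ : ℝ) (ω : ℕ → Round n k) : ℕ∞ :=
  ⨅ (t : ℕ) (_ : Initialized (trunc ω t) ∧ threshold n k t δ < glr A (trunc ω t)), (t : ℕ∞)

/-! ### Sampling rule -/

/-- A (possibly randomized) sampling rule: the conditional law of the next arm given the history. -/
structure SamplingRule (n k : ℕ) where
  next : (t : ℕ) → Kernel (History n k t) (Fin n)
  isMarkov : ∀ t, IsMarkovKernel (next t)

attribute [instance] SamplingRule.isMarkov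

/-- The set `𝒰_t` of under-sampled arms. -/
def underSampled (h : History n k t) : Set (Fin n) :=
  {i | (armCount h i : ℝ) ≤ max (√(t : ℝ) - n / 2) 0}

open Classical in
/-- The arms which D-tracking may pull after the history `h`: the least pulled under-sampled arms
if there is an under-sampled arm, and otherwise the arms with the largest
`t w*_i(μ̂(t), A) - N^X_i(t)`. -/
def dTracking [NeZero n] (A : Matrix (Fin k) (Fin n) ℝ) (h : History n k t) : Set (Fin n) :=
  if (underSampled h).Nonempty then
    {i | i ∈ underSampled h ∧ ∀ i' ∈ underSampled h, armCount h i ≤ armCount h i'}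
  else
    {i | ∀ i', t * optWeights A (empMean h) i' - armCount h i'
      ≤ t * optWeights A (empMean h) i - armCount h i}

/-- `π` is a sampling rule of the algorithm NSTS.

* Initialization: arms are pulled until each arm-context pair has been sampled. The order is free,
  as long as arms with missing contexts are not neglected: for some `M` and `c > 0`, if none of the
  last `M` pulls was a pull of an incompletely sampled arm, then the next one is with probability
  at least `c`. (Pulling only incompletely sampled arms, cycling through all arms and pulling arms
  uniformly at random are all of this form.)
* Afterwards the next arm is uniformly random if `μ̂(t)` has no unique best arm, and it is chosen
  by D-tracking, with arbitrary tie-breaking, otherwise. -/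
structure IsNSTS [NeZero n] (A : Matrix (Fin k) (Fin n) ℝ) (π : SamplingRule n k) : Prop where
  init : ∃ (M : ℕ) (c : ℝ≥0∞), 0 < c ∧ ∀ (t : ℕ) (h : History n k t), ¬ Initialized h → M ≤ t →
    (∀ s : Fin t, t ≤ s + M → (h s).1 ∉ incompleteArms h) → c ≤ π.next t h (incompleteArms h)
  uniform : ∀ (t : ℕ) (h : History n k t), Initialized h → empMean h ∉ uniqueBest A →
    ∀ i, π.next t h {i} = (n : ℝ≥0∞)⁻¹
  track : ∀ (t : ℕ) (h : History n k t), Initialized h → empMean h ∈ uniqueBest A →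
    π.next t h (dTracking A h) = 1

/-! ### The law of the interaction -/

/-- The joint law of `(Z, Y)` given `X = i`: `Z` has law `A_i`, and `Y` is Gaussian with mean
`μ_{Z,i}` and variance `1` given `Z`. -/
def armLaw (A : ContextMatrix n k) (μ : Matrix (Fin k) (Fin n) ℝ) (i : Fin n) :
    Measure (Fin k × ℝ) :=
  ∑ j, ENNReal.ofReal (A.prob j i) • (Measure.dirac j).prod (gaussianReal (μ j i) 1)

/-- The environment: the law of context and reward as a function of the arm. -/
def envKernel (A : ContextMatrix n k) (μ : Matrix (Fin k) (Fin n) ℝ) :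
    Kernel (Fin n) (Fin k × ℝ) :=
  Kernel.ofFunOfCountable (armLaw A μ)

instance (A : ContextMatrix n k) (μ : Matrix (Fin k) (Fin n) ℝ) :
    IsMarkovKernel (envKernel A μ) := by
  refine ⟨fun i ↦ ⟨?_⟩⟩
  change armLaw A μ i Set.univ = 1
  simp only [armLaw, Measure.coe_finsetSum, Finset.sum_apply, Measure.smul_apply,
    measure_univ, smul_eq_mul, mul_one]
  rw [← ENNReal.ofReal_sum_of_nonneg fun j _ ↦ (A.pos j i).le, A.sum_eq_one, ENNReal.ofReal_one]

/-- The conditional law of a round given the history: first the arm is drawn by the sampling rule,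
then context and reward by the environment. -/
def roundKernel (A : ContextMatrix n k) (μ : Matrix (Fin k) (Fin n) ℝ) (π : SamplingRule n k)
    (t : ℕ) : Kernel (History n k t) (Round n k) :=
  π.next t ⊗ₖ Kernel.prodMkLeft _ (envKernel A μ)

instance (A : ContextMatrix n k) (μ : Matrix (Fin k) (Fin n) ℝ) (π : SamplingRule n k) (t : ℕ) :
    IsMarkovKernel (roundKernel A μ π t) := by
  unfold roundKernel; infer_instance

/-- Rounds indexed by `{0, …, t}`, read as a history of length `t + 1`. -/
def toHistory (t : ℕ) (x : Finset.Iic t → Round n k) : History n k (t + 1) :=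
  fun s ↦ x ⟨s, Finset.mem_Iic.2 (Nat.lt_succ_iff.1 s.2)⟩

lemma measurable_toHistory (t : ℕ) : Measurable (toHistory (n := n) (k := k) t) :=
  measurable_pi_lambda _ fun _ ↦ measurable_pi_apply _

/-- The conditional law of the round with index `t + 1` given the rounds with index `0, …, t`. -/
def stepKernel (A : ContextMatrix n k) (μ : Matrix (Fin k) (Fin n) ℝ) (π : SamplingRule n k)
    (t : ℕ) : Kernel (Finset.Iic t → Round n k) (Round n k) :=
  (roundKernel A μ π (t + 1)).comap (toHistory t) (measurable_toHistory t)

instance (A : ContextMatrix n k) (μ : Matrix (Fin k) (Fin n) ℝ) (π : SamplingRule n k) (t : ℕ) :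
    IsMarkovKernel (stepKernel A μ π t) := by
  unfold stepKernel; infer_instance

/-- The law `ℙ_{μ,A}` of the infinite sequence of rounds played by the sampling rule `π`. -/
def trajLaw (A : ContextMatrix n k) (μ : Matrix (Fin k) (Fin n) ℝ) (π : SamplingRule n k) :
    Measure (ℕ → Round n k) :=
  Kernel.trajMeasure (X := fun _ ↦ Round n k) (roundKernel A μ π 0 Fin.elim0) (stepKernel A μ π)

/-- The expected number of rounds `𝔼_{μ,A}[τ_δ]`. -/
def expectedStop [NeZero n] (A : ContextMatrix n k) (μ : Matrix (Fin k) (Fin n) ℝ)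
    (π : SamplingRule n k) (δ : ℝ) : ℝ≥0∞ :=
  ∫⁻ ω, (stopTime A.prob δ ω : ℝ≥0∞) ∂(trajLaw A μ π)

/-- `d_B(p, q)`, the Kullback-Leibler divergence of the Bernoulli laws of parameters `p`, `q`. -/
def bernoulliKL (p q : ℝ) : ℝ :=
  p * Real.log (p / q) + (1 - p) * Real.log ((1 - p) / (1 - q))

end PostActionBAI

end

open PostActionBAI

noncomputable section

namespace PostActionBAI

/-! ### One-round extension of histories and the law of the trajectory -/

variable {n k : ℕ}

/-! This is a track-and-stop analysis. It needs only a lower bound on `glr`; correctness of the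
recommended arm plays no role. When the empirical means are close to μ, the pull proportions close
to the optimal weights and the context frequencies close to A, `glr` at time T is at least (1 - η)^3
T / T*(μ, A). The threshold is at most ηT + (1 + η) ln(1/δ) + C. Hence the stopping condition holds
at every T slightly beyond T*(μ, A) ln(1/δ), outside an event of probability at most q T, where q is
summable and free of δ. As τ is at most N plus the number of T ≥ N at which the condition fails, the
expectation is at most N + ∑ q (`expectedStop_le`).

Probability. An exponential Lyapunov function (`potential`) shows that initialization ends and that
forced exploration brings every arm to order √t pulls (`exists_measure_armCount_lt_le`). Exponential
supermartingales (`measure_le_sum_le`) then control context frequencies and empirical means. All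
failure probabilities at time t are O(t⁻³), so a union over the times in [εT, T] is still summable
in T.

Optimization. The objective is a minimum of concave functions. Its constraints are all tight at a
maximizer, and the exact concavity defect forces two maximizers to be proportional, hence equal.
Uniqueness and compactness make the optimal weights continuous in μ (`tendsto_optWeights`). So on a
window [εT, T] of good samples D-tracking never pulls an arm well above its quota, and since the
counts sum to T, no arm falls well below it (`le_armCount_of_tracking`).

Likelihood ratio. Jensen's inequality over contexts replaces the entries of an alternative by its
arm means. Keeping only the old and the new best arm, Cauchy-Schwarz produces the factor w_a w_b /
(w_a + w_b) of the objective (`mul_objective_le_glr`). -/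

/-- The history `h` extended by the round `r`. -/
def extend {t : ℕ} (h : History n k t) (r : Round n k) : History n k (t + 1) :=
  Fin.snoc (α := fun _ ↦ Round n k) h r

@[simp] lemma extend_castSucc {t : ℕ} (h : History n k t) (r : Round n k) (s : Fin t) :
    extend h r s.castSucc = h s := by simp [extend]

@[simp] lemma extend_last {t : ℕ} (h : History n k t) (r : Round n k) :
    extend h r (Fin.last t) = r := by simp [extend]

lemma trunc_succ (ω : ℕ → Round n k) (t : ℕ) : trunc ω (t + 1) = extend (trunc ω t) (ω t) := by
  funext s
  refine Fin.lastCases ?_ (fun s ↦ ?_) s <;> simp [trunc]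

lemma measurable_trunc (t : ℕ) : Measurable fun ω : ℕ → Round n k ↦ trunc ω t :=
  measurable_pi_lambda _ fun _ ↦ measurable_pi_apply _

lemma measurable_extend (t : ℕ) :
    Measurable fun p : History n k t × Round n k ↦ extend p.1 p.2 := by
  refine measurable_pi_lambda _ fun s ↦ ?_
  refine Fin.lastCases ?_ (fun s ↦ ?_) s
  · simpa using measurable_snd
  · simp only [extend_castSucc]
    exact (measurable_pi_apply s).comp measurable_fst

instance isProbabilityMeasure_trajLaw (A : ContextMatrix n k) (μ : Matrix (Fin k) (Fin n) ℝ)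
    (π : SamplingRule n k) : IsProbabilityMeasure (trajLaw A μ π) := by
  unfold trajLaw; infer_instance

lemma map_zero_trajMeasure {S : Type*} [MeasurableSpace S] (ν : Measure S)
    [IsProbabilityMeasure ν] (κ : (n : ℕ) → Kernel (Finset.Iic n → S) S)
    [∀ n, IsMarkovKernel (κ n)] :
    (Kernel.trajMeasure (X := fun _ ↦ S) ν κ).map (fun ω ↦ ω 0) = ν := by
  have hm : Measurable (MeasurableEquiv.piUnique (fun _ : Finset.Iic 0 ↦ S)) := by fun_prop
  have e : (Kernel.trajMeasure (X := fun _ ↦ S) ν κ).map (fun ω ↦ ω 0)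
      = ((Kernel.trajMeasure (X := fun _ ↦ S) ν κ).map (Preorder.frestrictLe 0)).map
        (MeasurableEquiv.piUnique (fun _ : Finset.Iic 0 ↦ S)) := by
    rw [Measure.map_map hm (by fun_prop)]
    rfl
  rw [e, Kernel.trajMeasure,
    Measure.map_comp _ _ (by fun_prop), Kernel.traj_map_frestrictLe, Kernel.partialTraj_self,
    Measure.id_comp]
  exact MeasurableEquiv.map_map_symm _

/-- The tower property for one round. Apart from total mass one, this is all that is used about
`trajLaw`. Round 0 is separate because its law is the initial measure and not one of the step
kernels. -/
lemma lintegral_trunc_succ (A : ContextMatrix n k) (μ : Matrix (Fin k) (Fin n) ℝ)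
    (π : SamplingRule n k) (t : ℕ) {F : History n k (t + 1) → ℝ≥0∞} (hF : Measurable F) :
    ∫⁻ ω, F (trunc ω (t + 1)) ∂trajLaw A μ π =
      ∫⁻ ω, ∫⁻ r, F (extend (trunc ω t) r) ∂roundKernel A μ π t (trunc ω t) ∂trajLaw A μ π := by
  have hF' : Measurable fun p : History n k t × Round n k ↦ F (extend p.1 p.2) :=
    hF.comp (measurable_extend t)
  simp_rw [trunc_succ]
  cases t with
  | zero =>
    have e : ∀ ω : ℕ → Round n k, trunc ω 0 = Fin.elim0 := fun ω ↦ Subsingleton.elim _ _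
    simp_rw [e, lintegral_const, measure_univ, mul_one]
    have := map_zero_trajMeasure (roundKernel A μ π 0 Fin.elim0) (stepKernel A μ π)
    have hG : Measurable fun r : Round n k ↦ F (extend Fin.elim0 r) :=
      hF'.comp measurable_prodMk_left
    calc _ = ∫⁻ r, F (extend Fin.elim0 r) ∂((trajLaw A μ π).map (fun ω ↦ ω 0)) :=
          (lintegral_map hG (measurable_pi_apply 0)).symm
      _ = _ := by rw [trajLaw, this]
  | succ a =>
    have key := Kernel.map_frestrictLe_trajMeasure_compProd_eq_map_trajMeasure
      (X := fun _ ↦ Round n k) (μ₀ := roundKernel A μ π 0 Fin.elim0) (κ := stepKernel A μ π)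
      (a := a)
    have hG : Measurable fun p : (Finset.Iic a → Round n k) × Round n k ↦
        F (extend (toHistory a p.1) p.2) :=
      hF'.comp (((measurable_toHistory a).comp measurable_fst).prodMk measurable_snd)
    have h1 : ∫⁻ ω, F (extend (trunc ω (a + 1)) (ω (a + 1))) ∂trajLaw A μ π =
        ∫⁻ p, F (extend (toHistory a p.1) p.2) ∂((trajLaw A μ π).map
          (fun x ↦ (Preorder.frestrictLe a x, x (a + 1)))) := by
      rw [lintegral_map hG (by fun_prop)]; rfl
    rw [h1, trajLaw, ← key, Measure.lintegral_compProd hG, lintegral_map _ (by fun_prop)]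
    · rfl
    · exact hG.lintegral_kernel_prod_right'

lemma lintegral_armLaw (A : ContextMatrix n k) (μ : Matrix (Fin k) (Fin n) ℝ) (i : Fin n)
    {G : Fin k × ℝ → ℝ≥0∞} (hG : Measurable G) :
    ∫⁻ p, G p ∂armLaw A μ i =
      ∑ j, ENNReal.ofReal (A.prob j i) * ∫⁻ y, G (j, y) ∂gaussianReal (μ j i) 1 := by
  rw [armLaw, lintegral_finsetSum_measure]
  refine Finset.sum_congr rfl fun j _ ↦ ?_
  rw [lintegral_smul_measure, lintegral_prod _ hG.aemeasurable, lintegral_dirac, smul_eq_mul]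

lemma lintegral_roundKernel (A : ContextMatrix n k) (μ : Matrix (Fin k) (Fin n) ℝ)
    (π : SamplingRule n k) (t : ℕ) (h : History n k t) {G : Round n k → ℝ≥0∞} (hG : Measurable G) :
    ∫⁻ r, G r ∂roundKernel A μ π t h =
      ∑ i, π.next t h {i} * ∫⁻ p, G (i, p) ∂armLaw A μ i := by
  rw [roundKernel, Kernel.lintegral_compProd _ _ _ hG, lintegral_fintype]
  refine Finset.sum_congr rfl fun i _ ↦ ?_
  rw [mul_comm]
  rfl

instance isProbabilityMeasure_armLaw (A : ContextMatrix n k) (μ : Matrix (Fin k) (Fin n) ℝ)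
    (i : Fin n) : IsProbabilityMeasure (armLaw A μ i) :=
  inferInstanceAs (IsProbabilityMeasure (envKernel A μ i))

/-- A nonnegative process whose conditional expectations do not increase has nonincreasing
expectation. -/
lemma lintegral_trunc_le (A : ContextMatrix n k) (μ : Matrix (Fin k) (Fin n) ℝ)
    (π : SamplingRule n k) {V : (t : ℕ) → History n k t → ℝ≥0∞} (hV : ∀ t, Measurable (V t))
    (hstep : ∀ t h, ∫⁻ r, V (t + 1) (extend h r) ∂roundKernel A μ π t h ≤ V t h)
    {c : ℝ≥0∞} (h0 : V 0 Fin.elim0 ≤ c) (t : ℕ) :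
    ∫⁻ ω, V t (trunc ω t) ∂trajLaw A μ π ≤ c := by
  induction t with
  | zero =>
    have e : ∀ ω : ℕ → Round n k, trunc ω 0 = Fin.elim0 := fun ω ↦ Subsingleton.elim _ _
    simpa [e] using h0
  | succ t ih =>
    rw [lintegral_trunc_succ A μ π t (hV _)]
    exact (lintegral_mono fun ω ↦ hstep t _).trans ih

/-- A property of the next round which holds conditionally on every history holds almost surely. -/
lemma ae_trunc_of_forall (A : ContextMatrix n k) (μ : Matrix (Fin k) (Fin n) ℝ)
    (π : SamplingRule n k) (t : ℕ) {B : Set (History n k (t + 1))} (hB : MeasurableSet B)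
    (hstep : ∀ h, ∀ᵐ r ∂roundKernel A μ π t h, extend h r ∈ B) :
    ∀ᵐ ω ∂trajLaw A μ π, trunc ω (t + 1) ∈ B := by
  rw [ae_iff]
  have hm : MeasurableSet {ω : ℕ → Round n k | trunc ω (t + 1) ∉ B} :=
    measurable_trunc (t + 1) hB.compl
  rw [← lintegral_indicator_one hm]
  have := lintegral_trunc_succ A μ π t (F := Bᶜ.indicator 1) (measurable_one.indicator hB.compl)
  refine (this.trans ?_ : _)
  have hz : ∀ h, ∫⁻ r, Bᶜ.indicator 1 (extend h r) ∂roundKernel A μ π t h = 0 := fun h ↦ by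
    refine (lintegral_eq_zero_iff ((measurable_one.indicator hB.compl).comp
      ((measurable_extend t).comp measurable_prodMk_left))).2 ?_
    filter_upwards [hstep h] with r hr
    simp [hr]
  simp [hz]

/-! ### Concentration -/

/-- The exponential of the sum is a supermartingale however the arms are chosen, so Markov's
inequality applies. Letting `f` vanish off one arm or pair handles random sample sizes without a
union bound over counts. -/
lemma measure_le_sum_le (A : ContextMatrix n k) (μ : Matrix (Fin k) (Fin n) ℝ)
    (π : SamplingRule n k) {f : Round n k → ℝ} (hf : Measurable f)
    (h1 : ∀ i, ∫⁻ p, ENNReal.ofReal (Real.exp (f (i, p))) ∂armLaw A μ i ≤ 1) (t : ℕ) (x : ℝ) :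
    trajLaw A μ π {ω | x ≤ ∑ s, f (trunc ω t s)} ≤ ENNReal.ofReal (Real.exp (-x)) := by
  have hmf : Measurable fun r ↦ ENNReal.ofReal (Real.exp (f r)) := by fun_prop
  have hsum : ∀ t, Measurable fun h : History n k t ↦ ∑ s, f (h s) := fun t ↦
    Finset.measurable_sum _ fun s _ ↦ hf.comp (measurable_pi_apply s)
  have hV : ∀ t, Measurable fun h : History n k t ↦ ENNReal.ofReal (Real.exp (∑ s, f (h s))) :=
    fun t ↦ (hsum t).exp.ennreal_ofReal
  have key := lintegral_trunc_le A μ π hV (c := 1) (fun t h ↦ ?_) (by simp) t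
  · have hm := mul_meas_ge_le_lintegral (μ := trajLaw A μ π)
      ((hV t).comp (measurable_trunc t)) (ENNReal.ofReal (Real.exp x))
    have hset : {ω : ℕ → Round n k | x ≤ ∑ s, f (trunc ω t s)} =
        {ω | ENNReal.ofReal (Real.exp x) ≤
          ((fun h : History n k t ↦ ENNReal.ofReal (Real.exp (∑ s, f (h s)))) ∘
            fun ω ↦ trunc ω t) ω} := by
      ext ω
      simp [ENNReal.ofReal_le_ofReal_iff (Real.exp_pos _).le]
    have hle := hm.trans key
    rw [← hset, mul_comm] at hle
    rw [Real.exp_neg, ENNReal.ofReal_inv_of_pos (Real.exp_pos _)]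
    rw [← one_div]
    exact (ENNReal.le_div_iff_mul_le (Or.inl (by simp [Real.exp_pos]))
      (Or.inl ENNReal.ofReal_ne_top)).2 hle
  · simp only [Fin.sum_univ_castSucc, extend_castSucc, extend_last, Real.exp_add]
    simp only [ENNReal.ofReal_mul (Real.exp_pos _).le]
    rw [lintegral_const_mul _ hmf]
    refine mul_le_of_le_one_right' ?_
    rw [lintegral_roundKernel _ _ _ _ _ hmf]
    calc _ ≤ ∑ i, π.next t h {i} := Finset.sum_le_sum fun i _ ↦ mul_le_of_le_one_right' (h1 i)
      _ = 1 := by simp [sum_measure_singleton]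

lemma lintegral_exp_gaussianReal (m c : ℝ) :
    ∫⁻ y, ENNReal.ofReal (Real.exp (c * (y - m) - c ^ 2 / 2)) ∂gaussianReal m 1 = 1 := by
  have hi := integrable_exp_mul_gaussianReal (μ := m) (v := 1) c
  have e : (fun y ↦ Real.exp (c * (y - m) - c ^ 2 / 2)) =
      fun y ↦ Real.exp (-(c * m) - c ^ 2 / 2) * Real.exp (c * y) := by
    funext y; rw [← Real.exp_add]; ring_nf
  change ∫⁻ y, ENNReal.ofReal ((fun y ↦ Real.exp (c * (y - m) - c ^ 2 / 2)) y) ∂_ = 1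
  rw [e, ← ofReal_integral_eq_lintegral_ofReal (hi.const_mul _)
    (Eventually.of_forall fun y ↦ by positivity), integral_const_mul]
  have := congrFun (mgf_id_gaussianReal (μ := m) (v := 1)) c
  simp only [mgf, id] at this
  rw [this, ← Real.exp_add, NNReal.coe_one, one_mul,
    show -(c * m) - c ^ 2 / 2 + (m * c + c ^ 2 / 2) = 0 by ring]
  simp

lemma armCount_eq_sum {t : ℕ} (h : History n k t) (i : Fin n) :
    armCount h i = ∑ s, if (h s).1 = i then 1 else 0 := Finset.card_filter _ _

lemma pairCount_eq_sum {t : ℕ} (h : History n k t) (j : Fin k) (i : Fin n) :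
    pairCount h j i = ∑ s, if (h s).1 = i ∧ (h s).2.1 = j then 1 else 0 := Finset.card_filter _ _

lemma armCount_extend {t : ℕ} (h : History n k t) (r : Round n k) (i : Fin n) :
    armCount (extend h r) i = armCount h i + if r.1 = i then 1 else 0 := by
  simp only [armCount_eq_sum, Fin.sum_univ_castSucc, extend_castSucc, extend_last]

lemma pairCount_extend {t : ℕ} (h : History n k t) (r : Round n k) (j : Fin k) (i : Fin n) :
    pairCount (extend h r) j i =
      pairCount h j i + if r.1 = i ∧ r.2.1 = j then 1 else 0 := by
  simp only [pairCount_eq_sum, Fin.sum_univ_castSucc, extend_castSucc, extend_last]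

lemma sum_armCount {t : ℕ} (h : History n k t) : ∑ i, armCount h i = t := by
  simp_rw [armCount_eq_sum]
  rw [Finset.sum_comm]
  simp

lemma pairCount_mul_empMean {t : ℕ} (h : History n k t) (j : Fin k) (i : Fin n) (m : ℝ) :
    pairCount h j i * (empMean h j i - m) =
      ∑ s, if (h s).1 = i ∧ (h s).2.1 = j then (h s).2.2 - m else 0 := by
  rw [← Finset.sum_filter, Finset.sum_sub_distrib, Finset.sum_const, nsmul_eq_mul, empMean, mul_sub]
  congr 1
  -- Without samples both sides vanish, whatever default value the empirical mean has.
  rcases Nat.eq_zero_or_pos (pairCount h j i) with h0 | h0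
  · rw [h0, Finset.card_eq_zero.1 h0]; simp
  · field_simp

lemma measurable_fst_eq_and (j : Fin k) (i : Fin n) :
    MeasurableSet {r : Round n k | r.1 = i ∧ r.2.1 = j} :=
  (measurableSet_eq_fun measurable_fst measurable_const).inter
    (measurableSet_eq_fun measurable_snd.fst measurable_const)

/-- The empirical frequency of a context is unlikely to be much smaller than its probability. -/
lemma measure_pairCount_lt_le (A : ContextMatrix n k) (μ : Matrix (Fin k) (Fin n) ℝ)
    (π : SamplingRule n k) (j : Fin k) (i : Fin n) {ε : ℝ} (h0 : 0 < ε) (h1 : ε ≤ 1) (t : ℕ)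
    (m : ℝ) :
    trajLaw A μ π {ω | m ≤ armCount (trunc ω t) i ∧
        (pairCount (trunc ω t) j i : ℝ) < (A.prob j i - ε) * armCount (trunc ω t) i} ≤
      ENNReal.ofReal (Real.exp (-(ε ^ 2 / 4 * m))) := by
  have hle : A.prob j i ≤ 1 := by
    rw [← A.sum_eq_one i]
    exact Finset.single_le_sum (fun j _ ↦ (A.pos j i).le) (Finset.mem_univ j)
  -- Tilt ε/2 with compensator ε²/4 per pull of `i`: on the event the tilt contributes more than
  -- ε²/2 per pull, leaving at least ε²/4 per pull, hence ε²/4 * m in total.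
  set f : Round n k → ℝ := fun r ↦ if r.1 = i then
    ε / 2 * (A.prob j i - if r.2.1 = j then 1 else 0) - ε ^ 2 / 4 else 0 with hf
  have hmf : Measurable f := by
    refine Measurable.ite (measurableSet_eq_fun measurable_fst measurable_const) ?_
      measurable_const
    refine ((measurable_const.sub (Measurable.ite ?_ measurable_const
      measurable_const)).const_mul _).sub_const _
    exact measurableSet_eq_fun measurable_snd.fst measurable_const
  refine le_trans (measure_mono ?_) (measure_le_sum_le A μ π hmf (fun i' ↦ ?_) t (ε ^ 2 / 4 * m))
  · rintro ω ⟨hm, hlt⟩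
    have hsum : ∑ s, f (trunc ω t s) =
        ε / 2 * (A.prob j i * armCount (trunc ω t) i - pairCount (trunc ω t) j i) -
          ε ^ 2 / 4 * armCount (trunc ω t) i := by
      rw [armCount_eq_sum, pairCount_eq_sum]
      push_cast
      rw [Finset.mul_sum, Finset.mul_sum, ← Finset.sum_sub_distrib, Finset.mul_sum,
        ← Finset.sum_sub_distrib]
      refine Finset.sum_congr rfl fun s _ ↦ ?_
      by_cases hs : (trunc ω t s).1 = i <;> simp [hf, hs]
    show ε ^ 2 / 4 * m ≤ ∑ s, f (trunc ω t s)
    rw [hsum]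
    nlinarith [mul_le_mul_of_nonneg_left hm (sq_nonneg ε), mul_pos h0 h0]
  · by_cases hi : i' = i
    · subst hi
      rw [lintegral_armLaw _ _ _ (by fun_prop)]
      have hint : ∀ j', ENNReal.ofReal (A.prob j' i') *
          ∫⁻ y, ENNReal.ofReal (Real.exp (f (i', j', y))) ∂gaussianReal (μ j' i') 1 =
          ENNReal.ofReal (A.prob j' i' * Real.exp (ε / 2 * (A.prob j i' - if j' = j then 1 else 0)
          - ε ^ 2 / 4)) := fun j' ↦ by
        have hc : ∀ y, f (i', j', y) =
            ε / 2 * (A.prob j i' - if j' = j then 1 else 0) - ε ^ 2 / 4 := fun y ↦ by simp [hf]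
        rw [ENNReal.ofReal_mul (A.pos _ i').le, lintegral_congr fun y ↦ by rw [hc y],
          lintegral_const, measure_univ, mul_one]
      rw [Finset.sum_congr rfl fun j' _ ↦ hint j']
      rw [← ENNReal.ofReal_sum_of_nonneg fun j' _ ↦ mul_nonneg (A.pos j' i').le (Real.exp_pos _).le,
        ENNReal.ofReal_le_one]
      -- Uses exp u ≤ 1 + u + u² for |u| ≤ 1. The linear term is centred and cancels in the sum over
      -- contexts; what remains is 1 + ε²/4 ≤ exp(ε²/4).
      have hb : ∀ j', A.prob j' i' * Real.exp (ε / 2 * (A.prob j i' - if j' = j then 1 else 0)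
          - ε ^ 2 / 4) ≤ Real.exp (-(ε ^ 2 / 4)) * (A.prob j' i' * (1 + ε ^ 2 / 4) + ε / 2 *
            (A.prob j' i' * A.prob j i' - if j' = j then A.prob j' i' else 0)) := by
        intro j'
        rw [sub_eq_add_neg, Real.exp_add, mul_comm (Real.exp (ε / 2 * _)), mul_left_comm]
        refine mul_le_mul_of_nonneg_left ?_ (Real.exp_pos _).le
        set d : ℝ := A.prob j i' - if j' = j then 1 else 0 with hd
        have hd1 : d ^ 2 ≤ 1 := by
          have := A.pos j i'
          rw [hd]; split_ifs <;> nlinarith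
        have hd2 : |ε / 2 * d| ≤ 1 := by
          rw [← sq_le_one_iff_abs_le_one, mul_pow]
          exact mul_le_one₀ (by nlinarith) (sq_nonneg d) hd1
        have he := (abs_le.1 (Real.abs_exp_sub_one_sub_id_le hd2)).2
        have : Real.exp (ε / 2 * d) ≤ 1 + ε ^ 2 / 4 + ε / 2 * d := by nlinarith
        have h3 := mul_le_mul_of_nonneg_left this (A.pos j' i').le
        refine h3.trans (le_of_eq ?_)
        rw [hd]; split_ifs <;> ring
      refine (Finset.sum_le_sum fun j' _ ↦ hb j').trans ?_
      rw [← Finset.mul_sum, Finset.sum_add_distrib, ← Finset.sum_mul, ← Finset.mul_sum,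
        Finset.sum_sub_distrib, ← Finset.sum_mul, A.sum_eq_one]
      simp only [Finset.sum_ite_eq', Finset.mem_univ, if_true, one_mul, sub_self, mul_zero,
        add_zero]
      rw [Real.exp_neg, inv_mul_le_one₀ (Real.exp_pos _)]
      linarith [Real.add_one_le_exp (ε ^ 2 / 4)]
    · simp [hf, hi]

/-- The sign of `c` selects the tail, so the two-sided bound comes from ε and -ε. The Gaussian
increments c(Y - μ) - c²/2 have exponential moment exactly 1, and on the event they add up to at
least c²/2 per observation. -/
lemma measure_mul_sub_ge_le (A : ContextMatrix n k) (μ : Matrix (Fin k) (Fin n) ℝ)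
    (π : SamplingRule n k) (j : Fin k) (i : Fin n) (c : ℝ) (t : ℕ) (m : ℝ) :
    trajLaw A μ π {ω | m ≤ pairCount (trunc ω t) j i ∧
        c ^ 2 ≤ c * (empMean (trunc ω t) j i - μ j i)} ≤
      ENNReal.ofReal (Real.exp (-(c ^ 2 / 2 * m))) := by
  set f : Round n k → ℝ := fun r ↦ if r.1 = i ∧ r.2.1 = j then
    c * (r.2.2 - μ j i) - c ^ 2 / 2 else 0 with hf
  have hmf : Measurable f :=
    Measurable.ite (measurable_fst_eq_and j i)
      (((measurable_snd.snd.sub_const _).const_mul _).sub_const _) measurable_const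
  refine le_trans (measure_mono ?_) (measure_le_sum_le A μ π hmf (fun i' ↦ ?_) t (c ^ 2 / 2 * m))
  · rintro ω ⟨hm, hc⟩
    have hsum : ∑ s, f (trunc ω t s) = c *
        (pairCount (trunc ω t) j i * (empMean (trunc ω t) j i - μ j i)) -
          c ^ 2 / 2 * pairCount (trunc ω t) j i := by
      rw [pairCount_mul_empMean, pairCount_eq_sum]
      push_cast
      rw [Finset.mul_sum, Finset.mul_sum, ← Finset.sum_sub_distrib]
      refine Finset.sum_congr rfl fun s _ ↦ ?_
      by_cases hs : (trunc ω t s).1 = i ∧ (trunc ω t s).2.1 = j <;> simp [hf, hs]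
    show c ^ 2 / 2 * m ≤ ∑ s, f (trunc ω t s)
    rw [hsum]
    have hN : (0 : ℝ) ≤ pairCount (trunc ω t) j i := Nat.cast_nonneg _
    nlinarith [mul_le_mul_of_nonneg_left hm (sq_nonneg c), mul_le_mul_of_nonneg_left hc hN]
  · rw [lintegral_armLaw _ _ _ (by fun_prop)]
    calc _ = ∑ j', ENNReal.ofReal (A.prob j' i') := by
          refine Finset.sum_congr rfl fun j' _ ↦ ?_
          by_cases hs : i' = i ∧ j' = j
          · obtain ⟨rfl, rfl⟩ := hs
            simp [hf, lintegral_exp_gaussianReal]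
          · simp [hf, hs]
      _ = 1 := by
          rw [← ENNReal.ofReal_sum_of_nonneg fun j _ ↦ (A.pos j i').le, A.sum_eq_one,
            ENNReal.ofReal_one]
      _ ≤ 1 := le_rfl

/-- Empirical means of many samples are close to the true means. -/
lemma measure_abs_empMean_sub_ge_le (A : ContextMatrix n k) (μ : Matrix (Fin k) (Fin n) ℝ)
    (π : SamplingRule n k) (j : Fin k) (i : Fin n) {ε : ℝ} (h0 : 0 < ε) (t : ℕ) (m : ℝ) :
    trajLaw A μ π {ω | m ≤ pairCount (trunc ω t) j i ∧
        ε ≤ |empMean (trunc ω t) j i - μ j i|} ≤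
      2 * ENNReal.ofReal (Real.exp (-(ε ^ 2 / 2 * m))) := by
  have h1 := measure_mul_sub_ge_le A μ π j i ε t m
  have h2 := measure_mul_sub_ge_le A μ π j i (-ε) t m
  rw [neg_sq] at h2
  rw [two_mul]
  refine le_trans (measure_mono ?_) ((measure_union_le _ _).trans (add_le_add h1 h2))
  rintro ω ⟨hm, hε⟩
  rcases le_abs.1 hε with h | h
  · exact Or.inl ⟨hm, by nlinarith⟩
  · exact Or.inr ⟨hm, by nlinarith⟩

/-! ### Exploration -/

/-- Since lo ≤ hi, more mass on `G` only lowers the average, so a lower bound `c` on that mass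
suffices. -/
lemma lintegral_le_of_le_on {Ω : Type*} [MeasurableSpace Ω] (ν : Measure Ω)
    [IsProbabilityMeasure ν] {G : Set Ω} (hGm : MeasurableSet G) {c lo hi : ℝ}
    (hlo : 0 ≤ lo) (hle : lo ≤ hi) (hG : ENNReal.ofReal c ≤ ν G) {e : Ω → ℝ≥0∞}
    (h1 : ∀ x ∈ G, e x ≤ ENNReal.ofReal lo) (h2 : ∀ x ∉ G, e x ≤ ENNReal.ofReal hi) :
    ∫⁻ x, e x ∂ν ≤ ENNReal.ofReal (c * lo + (1 - c) * hi) := by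
  have hq : ν G = ENNReal.ofReal (ν.real G) := by simp
  have hq1 : ν.real G ≤ 1 := measureReal_le_one
  have hcq : c ≤ ν.real G := by
    rw [hq] at hG
    exact (ENNReal.ofReal_le_ofReal_iff measureReal_nonneg).1 hG
  have hGc : ν Gᶜ = ENNReal.ofReal (1 - ν.real G) := by
    rw [← probReal_compl_eq_one_sub hGm]; simp
  calc ∫⁻ x, e x ∂ν = ∫⁻ x in G, e x ∂ν + ∫⁻ x in Gᶜ, e x ∂ν := (lintegral_add_compl _ hGm).symm
    _ ≤ ∫⁻ _ in G, ENNReal.ofReal lo ∂ν + ∫⁻ _ in Gᶜ, ENNReal.ofReal hi ∂ν :=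
        add_le_add (setLIntegral_mono' hGm h1) (setLIntegral_mono' hGm.compl h2)
    _ = ENNReal.ofReal (lo * ν.real G + hi * (1 - ν.real G)) := by
        rw [setLIntegral_const, setLIntegral_const, hq, hGc,
          ← ENNReal.ofReal_mul hlo, ← ENNReal.ofReal_mul (hlo.trans hle),
          ← ENNReal.ofReal_add (by positivity)
            (mul_nonneg (hlo.trans hle) (by linarith))]
    _ ≤ _ := ENNReal.ofReal_le_ofReal (by nlinarith)

/-- The history `h` with all rewards replaced by `0`. -/
def eraseRewards {t : ℕ} (h : History n k t) : History n k t := fun s ↦ ((h s).1, (h s).2.1, 0)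

/-- Such a function factors through the finitely many sequences of arms and contexts, where every
map is measurable. -/
lemma measurable_of_eraseRewards {t : ℕ} {E : Type*} [MeasurableSpace E] {f : History n k t → E}
    (hf : ∀ h, f h = f (eraseRewards h)) : Measurable f := by
  let F : (Fin t → Fin n × Fin k) → E := fun y ↦ f fun s ↦ ((y s).1, (y s).2, 0)
  have e : f = F ∘ fun h s ↦ ((h s).1, (h s).2.1) := funext hf
  rw [e]
  refine (measurable_of_countable F).comp (measurable_pi_lambda _ fun s ↦ ?_)
  have : Measurable fun h : History n k t ↦ h s := measurable_pi_apply s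
  fun_prop

/-- The number of arm-context pairs which have not been observed. -/
def missing {t : ℕ} (h : History n k t) : ℕ :=
  (Finset.univ.filter fun p : Fin k × Fin n ↦ pairCount h p.1 p.2 = 0).card

/-- The number of pulls needed for all arms to have been pulled `L` times. -/
def deficit (L : ℕ) {t : ℕ} (h : History n k t) : ℕ := ∑ i, (L - armCount h i)

open Classical in
/-- `M` minus the number of rounds since the last pull of an arm which still is incompletely
sampled. -/
def recency (M : ℕ) {t : ℕ} (h : History n k t) : ℕ :=
  (M - t) ⊔ (Finset.univ.filter fun s ↦ (h s).1 ∈ incompleteArms h).sup fun s ↦ s + 1 + M - t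

lemma pairCount_le_extend {t : ℕ} (h : History n k t) (r : Round n k) (j : Fin k) (i : Fin n) :
    pairCount h j i ≤ pairCount (extend h r) j i := by
  rw [pairCount_extend]; exact Nat.le_add_right _ _

lemma armCount_le_extend {t : ℕ} (h : History n k t) (r : Round n k) (i : Fin n) :
    armCount h i ≤ armCount (extend h r) i := by
  rw [armCount_extend]; exact Nat.le_add_right _ _

lemma Initialized.extend {t : ℕ} {h : History n k t} (hh : Initialized h) (r : Round n k) :
    Initialized (extend h r) := fun j i ↦ (hh j i).trans_le (pairCount_le_extend h r j i)

lemma incompleteArms_extend_subset {t : ℕ} (h : History n k t) (r : Round n k) :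
    incompleteArms (extend h r) ⊆ incompleteArms h := by
  rintro i ⟨j, hj⟩
  exact ⟨j, Nat.eq_zero_of_le_zero (hj ▸ pairCount_le_extend h r j i)⟩

lemma missing_extend_le {t : ℕ} (h : History n k t) (r : Round n k) :
    missing (extend h r) ≤ missing h := by
  refine Finset.card_le_card fun p hp ↦ ?_
  simp only [Finset.mem_filter, Finset.mem_univ, true_and] at hp ⊢
  exact Nat.eq_zero_of_le_zero (hp ▸ pairCount_le_extend h r p.1 p.2)

lemma missing_extend_lt {t : ℕ} {h : History n k t} {r : Round n k}
    (hr : pairCount h r.2.1 r.1 = 0) : missing (extend h r) < missing h := by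
  refine Finset.card_lt_card ⟨fun p hp ↦ ?_, fun hs ↦ ?_⟩
  · simp only [Finset.mem_filter, Finset.mem_univ, true_and] at hp ⊢
    exact Nat.eq_zero_of_le_zero (hp ▸ pairCount_le_extend h r p.1 p.2)
  · have := hs (Finset.mem_filter.2 ⟨Finset.mem_univ (r.2.1, r.1), hr⟩)
    simp [pairCount_extend] at this

lemma missing_le {t : ℕ} (h : History n k t) : missing h ≤ k * n := by
  refine (Finset.card_le_univ _).trans ?_
  simp

lemma deficit_extend_le (L : ℕ) {t : ℕ} (h : History n k t) (r : Round n k) :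
    deficit L (extend h r) ≤ deficit L h :=
  Finset.sum_le_sum fun i _ ↦ Nat.sub_le_sub_left (armCount_le_extend h r i) L

lemma deficit_extend_lt {L : ℕ} {t : ℕ} {h : History n k t} {r : Round n k}
    (hr : armCount h r.1 < L) : deficit L (extend h r) < deficit L h := by
  refine Finset.sum_lt_sum
    (fun i _ ↦ Nat.sub_le_sub_left (armCount_le_extend h r i) L) ⟨r.1, Finset.mem_univ _, ?_⟩
  rw [armCount_extend]
  simp only [if_true]
  omega

lemma deficit_le (L : ℕ) {t : ℕ} (h : History n k t) : deficit L h ≤ n * L := by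
  refine (Finset.sum_le_sum fun i _ ↦ Nat.sub_le L _).trans ?_
  simp

lemma deficit_eq_zero {L : ℕ} {t : ℕ} {h : History n k t} :
    deficit L h = 0 ↔ ∀ i, L ≤ armCount h i := by
  simp [deficit, Nat.sub_eq_zero_iff_le]

lemma recency_le (M : ℕ) {t : ℕ} (h : History n k t) : recency M h ≤ M := by
  refine sup_le (Nat.sub_le _ _) (Finset.sup_le fun s _ ↦ ?_)
  have := s.2
  omega

/-- Pulling a complete arm makes earlier pulls of incomplete arms one round older, and incomplete
arms never become more numerous. -/
lemma recency_extend_le (M : ℕ) {t : ℕ} {h : History n k t} {r : Round n k}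
    (hr : r.1 ∉ incompleteArms h) : recency M (extend h r) ≤ recency M h - 1 := by
  classical
  refine sup_le ?_ (Finset.sup_le fun s hs ↦ ?_)
  · have : M - t ≤ recency M h := le_sup_left
    omega
  · replace hs := (Finset.mem_filter.1 hs).2
    have hs' := incompleteArms_extend_subset _ _ hs
    revert hs'
    refine Fin.lastCases (fun hs' ↦ ?_) (fun s hs' ↦ ?_) s
    · rw [extend_last] at hs'
      exact absurd hs' hr
    · rw [extend_castSucc] at hs'
      have : (s : ℕ) + 1 + M - t ≤ recency M h :=
        le_sup_of_le_right (Finset.le_sup (f := fun s : Fin t ↦ (s : ℕ) + 1 + M - t)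
          (Finset.mem_filter.2 ⟨Finset.mem_univ s, hs'⟩))
      simp only [Fin.val_castSucc]
      omega

/-- When the counter has run out, the premise of `IsNSTS.init` holds and an incomplete arm must be
pulled with probability at least c. -/
lemma le_and_notMem_of_recency_eq_zero {M : ℕ} {t : ℕ} {h : History n k t}
    (h0 : recency M h = 0) :
    M ≤ t ∧ ∀ s : Fin t, t ≤ s + M → (h s).1 ∉ incompleteArms h := by
  classical
  constructor
  · have : M - t ≤ recency M h := le_sup_left
    omega
  · intro s hs hmem
    have : (s : ℕ) + 1 + M - t ≤ recency M h :=
        le_sup_of_le_right (Finset.le_sup (f := fun s : Fin t ↦ (s : ℕ) + 1 + M - t)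
          (Finset.mem_filter.2 ⟨Finset.mem_univ s, hmem⟩))
    omega

open Classical in
/-- A Lyapunov function for the initialization and the forced exploration. -/
def potential (b : ℝ) (M L t₁ : ℕ) (t : ℕ) (h : History n k t) : ℝ :=
  b ^ (t - t₁) * if Initialized h then if deficit L h = 0 then 0 else 2 ^ deficit L h
    else 2 ^ missing h * b ^ recency M h * 2 ^ (n * L)

lemma measurable_potential (b : ℝ) (M L t₁ t : ℕ) :
    Measurable (potential (n := n) (k := k) b M L t₁ t) :=
  measurable_of_eraseRewards fun _ ↦ rfl

/-- The initialization formula dominates in both phases because the deficit never exceeds `n * L`.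
This covers the round in which initialization ends. -/
lemma potential_le {b : ℝ} (hb : 1 ≤ b) (M L t₁ : ℕ) {t : ℕ} (h : History n k t) :
    potential b M L t₁ t h ≤ b ^ (t - t₁) * (2 ^ missing h * b ^ recency M h * 2 ^ (n * L)) := by
  refine mul_le_mul_of_nonneg_left ?_ (by positivity)
  have h2 : (2 : ℝ) ^ deficit L h ≤ 2 ^ (n * L) := pow_le_pow_right₀ one_le_two (deficit_le L h)
  have h3 : (1 : ℝ) ≤ 2 ^ missing h * b ^ recency M h :=
    one_le_mul_of_one_le_of_one_le (one_le_pow₀ one_le_two) (one_le_pow₀ hb)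
  split_ifs
  · positivity
  · nlinarith [pow_pos (two_pos (α := ℝ)) (n * L)]
  · exact le_rfl

/-- Once the exploration level is at least `L`, every arm with fewer than `L` pulls is
under-sampled, and the least pulled under-sampled arm lies below `L` as well. -/
lemma exists_armCount_lt_of_mem_dTracking [NeZero n] {A : Matrix (Fin k) (Fin n) ℝ} {L t : ℕ}
    {h : History n k t} (hL : (L : ℝ) ≤ √(t : ℝ) - n / 2) (hd : deficit L h ≠ 0) {i : Fin n}
    (hi : i ∈ dTracking A h) : armCount h i < L := by
  obtain ⟨i₀, hi₀⟩ : ∃ i, armCount h i < L := by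
    by_contra! hcon
    exact hd (deficit_eq_zero.2 hcon)
  have hU : i₀ ∈ underSampled h := by
    have : (armCount h i₀ : ℝ) ≤ L := by exact_mod_cast hi₀.le
    exact (this.trans hL).trans (le_max_left _ _)
  rw [dTracking, if_pos ⟨i₀, hU⟩] at hi
  exact (hi.2 i₀ hU).trans_lt hi₀

lemma armLaw_singleton_prod (A : ContextMatrix n k) (μ : Matrix (Fin k) (Fin n) ℝ) (i : Fin n)
    (j : Fin k) : armLaw A μ i {p | p.1 = j} = ENNReal.ofReal (A.prob j i) := by
  have hm : MeasurableSet {p : Fin k × ℝ | p.1 = j} :=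
    measurableSet_eq_fun measurable_fst measurable_const
  rw [← lintegral_indicator_one hm, lintegral_armLaw _ _ _ (measurable_one.indicator hm),
    Finset.sum_eq_single j]
  · simp
  · intro j' _ hj'
    simp [Set.indicator, hj']
  · simp

lemma lintegral_roundKernel' (A : ContextMatrix n k) (μ : Matrix (Fin k) (Fin n) ℝ)
    (π : SamplingRule n k) (t : ℕ) (h : History n k t) {G : Round n k → ℝ≥0∞} (hG : Measurable G) :
    ∫⁻ r, G r ∂roundKernel A μ π t h = ∫⁻ i, ∫⁻ p, G (i, p) ∂armLaw A μ i ∂π.next t h := by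
  rw [lintegral_roundKernel _ _ _ _ _ hG, lintegral_fintype]
  exact Finset.sum_congr rfl fun i _ ↦ mul_comm _ _

lemma lintegral_le_of_forall_le {Ω : Type*} [MeasurableSpace Ω] (ν : Measure Ω)
    [IsProbabilityMeasure ν] {e : Ω → ℝ≥0∞} {c : ℝ≥0∞} (h : ∀ x, e x ≤ c) : ∫⁻ x, e x ∂ν ≤ c :=
  (lintegral_mono h).trans (by simp)

/-- An arm with fewer than `L` pulls is drawn with probability at least 1/n: surely under tracking,
by one favourable arm under the uniform rule. That at least halves 2^deficit, a mean factor 1 -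
1/(2n), which absorbs the growth `b` per round. -/
lemma lintegral_potential_le_of_initialized [NeZero n] (A : ContextMatrix n k)
    (μ : Matrix (Fin k) (Fin n) ℝ) (π : SamplingRule n k) (hπ : IsNSTS A.prob π) {b : ℝ}
    (hb : 1 ≤ b) (hbn : b * (1 - 1 / (2 * n)) ≤ 1) (M : ℕ) {L t₁ : ℕ}
    (hL : (L : ℝ) ≤ √(t₁ : ℝ) - n / 2) {t : ℕ} {h : History n k t} (hh : Initialized h) :
    ∫⁻ r, ENNReal.ofReal (potential b M L t₁ (t + 1) (extend h r)) ∂roundKernel A μ π t h ≤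
      ENNReal.ofReal (potential b M L t₁ t h) := by
  by_cases hd : deficit L h = 0
  · have hz : ∀ r, potential b M L t₁ (t + 1) (extend h r) = 0 := fun r ↦ by
      rw [potential, if_pos (hh.extend r),
        if_pos (Nat.eq_zero_of_le_zero (hd ▸ deficit_extend_le L h r)), mul_zero]
    simp [hz]
  have hU : potential b M L t₁ t h = b ^ (t - t₁) * 2 ^ deficit L h := by
    rw [potential, if_pos hh, if_neg hd]
  have hle : ∀ r, potential b M L t₁ (t + 1) (extend h r) ≤
      b ^ (t + 1 - t₁) * 2 ^ deficit L (extend h r) := fun r ↦ by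
    rw [potential, if_pos (hh.extend r)]
    refine mul_le_mul_of_nonneg_left ?_ (by positivity)
    split_ifs
    · positivity
    · exact le_rfl
  have hle' : ∀ r, potential b M L t₁ (t + 1) (extend h r) ≤
      b ^ (t + 1 - t₁) * 2 ^ deficit L h := fun r ↦
    (hle r).trans (mul_le_mul_of_nonneg_left
      (pow_le_pow_right₀ one_le_two (deficit_extend_le L h r)) (by positivity))
  rcases lt_or_ge t t₁ with ht | ht
  -- Before `t₁` the truncated exponents of `b` are 0, so monotonicity of the deficit is enough and
  -- no exploration is needed.
  · have e1 : t + 1 - t₁ = 0 := by omega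
    have e2 : t - t₁ = 0 := by omega
    rw [e1] at hle'
    rw [hU, e2]
    exact lintegral_le_of_forall_le _ fun r ↦ ENNReal.ofReal_le_ofReal (hle' r)
  have hLt : (L : ℝ) ≤ √(t : ℝ) - n / 2 :=
    hL.trans (sub_le_sub_right (Real.sqrt_le_sqrt (by exact_mod_cast ht)) _)
  have hn : (0 : ℝ) < n := by exact_mod_cast Nat.pos_of_ne_zero (NeZero.ne n)
  have hn1 : (1 : ℝ) ≤ n := by exact_mod_cast Nat.one_le_iff_ne_zero.2 (NeZero.ne n)
  have hprob : ENNReal.ofReal (1 / n) ≤ π.next t h {i | armCount h i < L} := by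
    by_cases hu : empMean h ∈ uniqueBest A.prob
    · have h1 := hπ.track t h hh hu
      have hsub : dTracking A.prob h ⊆ {i | armCount h i < L} := fun i hi ↦
        exists_armCount_lt_of_mem_dTracking hLt hd hi
      refine le_trans ?_ (measure_mono hsub)
      rw [h1, ENNReal.ofReal_le_one, div_le_one hn]
      exact hn1
    · obtain ⟨i, hi⟩ : ∃ i, armCount h i < L := by
        by_contra! hcon
        exact hd (deficit_eq_zero.2 hcon)
      have hsub : {i} ⊆ {i | armCount h i < L} := Set.singleton_subset_iff.2 hi
      refine le_trans (le_of_eq ?_) (measure_mono hsub)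
      rw [hπ.uniform t h hh hu i, one_div, ENNReal.ofReal_inv_of_pos hn, ENNReal.ofReal_natCast]
  have hm : Measurable fun r ↦ ENNReal.ofReal (potential b M L t₁ (t + 1) (extend h r)) :=
    ((measurable_potential b M L t₁ (t + 1)).comp
      ((measurable_extend t).comp measurable_prodMk_left)).ennreal_ofReal
  rw [lintegral_roundKernel' _ _ _ _ _ hm]
  set P : ℝ := b ^ (t + 1 - t₁) * 2 ^ deficit L h with hP
  have hP0 : 0 ≤ P := by positivity
  refine (lintegral_le_of_le_on (π.next t h) (G := {i | armCount h i < L})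
    (Set.toFinite _).measurableSet (lo := P / 2) (hi := P) (by positivity) (by linarith)
    hprob (fun i hi ↦ ?_) (fun i _ ↦ ?_)).trans (ENNReal.ofReal_le_ofReal ?_)
  · refine lintegral_le_of_forall_le _ fun p ↦ ENNReal.ofReal_le_ofReal ((hle _).trans ?_)
    rw [hP, mul_div_assoc]
    refine mul_le_mul_of_nonneg_left ?_ (by positivity)
    have hlt : deficit L (extend h (i, p)) < deficit L h := deficit_extend_lt hi
    rw [le_div_iff₀ two_pos, ← pow_succ]
    exact pow_le_pow_right₀ one_le_two hlt
  · exact lintegral_le_of_forall_le _ fun p ↦ ENNReal.ofReal_le_ofReal (hle' _)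
  · rw [hU]
    have hPe : P = b * (b ^ (t - t₁) * 2 ^ deficit L h) := by
      rw [hP, Nat.sub_add_comm ht, pow_succ]; ring
    have hQ : 0 ≤ b ^ (t - t₁) * (2 : ℝ) ^ deficit L h := by positivity
    calc 1 / (n : ℝ) * (P / 2) + (1 - 1 / n) * P
        = (b ^ (t - t₁) * 2 ^ deficit L h) * (b * (1 - 1 / (2 * n))) := by rw [hPe]; field_simp; ring
      _ ≤ _ := mul_le_of_le_one_right hQ hbn

/-- Pulling an incomplete arm reveals a missing pair with probability at least `x`, which halves
2^missing; resetting the recency costs at most b^M. Pulling a complete arm lowers a positive recency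
by one, which pays for the growth `b`. At recency 0 the probability `c` of an incomplete arm pays
instead. -/
lemma lintegral_potential_le_of_not_initialized (A : ContextMatrix n k)
    (μ : Matrix (Fin k) (Fin n) ℝ) (π : SamplingRule n k) {M : ℕ} {b c x : ℝ} (hb : 1 ≤ b)
    (hxA : ∀ j i, x ≤ A.prob j i) (hbx : b ^ M * (1 - x / 2) ≤ 1)
    (hbc : b * (c * (b ^ M * (1 - x / 2)) + (1 - c)) ≤ 1)
    {t : ℕ} {h : History n k t} (hh : ¬ Initialized h)
    (hπ : M ≤ t → (∀ s : Fin t, t ≤ s + M → (h s).1 ∉ incompleteArms h) →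
      ENNReal.ofReal c ≤ π.next t h (incompleteArms h)) (L t₁ : ℕ) :
    ∫⁻ r, ENNReal.ofReal (potential b M L t₁ (t + 1) (extend h r)) ∂roundKernel A μ π t h ≤
      ENNReal.ofReal (potential b M L t₁ t h) := by
  have hb0 : 0 < b := by linarith
  set K : ℝ := b ^ (t - t₁) * 2 ^ (n * L) * 2 ^ missing h with hK
  have hK0 : 0 ≤ K := by positivity
  have hU : potential b M L t₁ t h = K * b ^ recency M h := by
    rw [potential, if_neg hh]; ring
  have hle : ∀ r, potential b M L t₁ (t + 1) (extend h r) ≤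
      b ^ (t - t₁) * 2 ^ (n * L) * 2 ^ missing (extend h r) * (b * b ^ recency M (extend h r)) :=
    fun r ↦ by
      refine (potential_le hb M L t₁ _).trans ?_
      have h1 : b ^ (t + 1 - t₁) ≤ b ^ (t - t₁) * b := by
        rw [← pow_succ]; exact pow_le_pow_right₀ hb (by omega)
      refine (mul_le_mul_of_nonneg_right h1 (by positivity)).trans (le_of_eq (by ring))
  have hle' : ∀ r (e : ℕ), recency M (extend h r) ≤ e →
      potential b M L t₁ (t + 1) (extend h r) ≤ K * (b * b ^ e) := fun r e he ↦ by
    refine (hle r).trans ?_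
    have h1 : (2 : ℝ) ^ missing (extend h r) ≤ 2 ^ missing h :=
      pow_le_pow_right₀ one_le_two (missing_extend_le h r)
    have h2 : b ^ recency M (extend h r) ≤ b ^ e := pow_le_pow_right₀ hb he
    rw [hK]
    gcongr
  have hx1 : x ≤ 1 ∨ (incompleteArms h = ∅) := by
    by_contra! hcon
    obtain ⟨hx1, i, j, -⟩ := hcon
    have : A.prob j i ≤ 1 := by
      rw [← A.sum_eq_one i]
      exact Finset.single_le_sum (fun j _ ↦ (A.pos j i).le) (Finset.mem_univ j)
    linarith [hxA j i]
  have hm : Measurable fun r ↦ ENNReal.ofReal (potential b M L t₁ (t + 1) (extend h r)) :=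
    ((measurable_potential b M L t₁ (t + 1)).comp
      ((measurable_extend t).comp measurable_prodMk_left)).ennreal_ofReal
  have hinc : ∀ i ∈ incompleteArms h,
      ∫⁻ p, ENNReal.ofReal (potential b M L t₁ (t + 1) (extend h (i, p))) ∂armLaw A μ i ≤
        ENNReal.ofReal (K * (b * (b ^ M * (1 - x / 2)))) := by
    rintro i ⟨j, hj⟩
    have hQ : 0 ≤ K * (b * b ^ M) := by positivity
    refine (lintegral_le_of_le_on (armLaw A μ i) (G := {p | p.1 = j}) (c := x)
      (measurableSet_eq_fun measurable_fst measurable_const) (lo := K * (b * b ^ M) / 2)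
      (hi := K * (b * b ^ M)) (by positivity) (by linarith) ?_ (fun p hp ↦ ?_)
      (fun p _ ↦ ?_)).trans (le_of_eq (congrArg _ (by ring)))
    · rw [armLaw_singleton_prod]
      exact ENNReal.ofReal_le_ofReal (hxA j i)
    · refine ENNReal.ofReal_le_ofReal ((hle _).trans ?_)
      have hp' : p.1 = j := hp
      have hlt : missing (extend h (i, p)) < missing h :=
        missing_extend_lt (by simpa [hp'] using hj)
      have h1 : (2 : ℝ) ^ missing (extend h (i, p)) ≤ 2 ^ missing h / 2 := by
        rw [le_div_iff₀ two_pos, ← pow_succ]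
        exact pow_le_pow_right₀ one_le_two hlt
      have h2 : b ^ recency M (extend h (i, p)) ≤ b ^ M :=
        pow_le_pow_right₀ hb (recency_le M _)
      calc _ ≤ b ^ (t - t₁) * 2 ^ (n * L) * (2 ^ missing h / 2) * (b * b ^ M) := by gcongr
        _ = _ := by rw [hK]; ring
    · exact ENNReal.ofReal_le_ofReal (hle' _ _ (recency_le M _))
  have hcomp : ∀ i ∉ incompleteArms h,
      ∫⁻ p, ENNReal.ofReal (potential b M L t₁ (t + 1) (extend h (i, p))) ∂armLaw A μ i ≤
        ENNReal.ofReal (K * (b * b ^ (recency M h - 1))) := fun i hi ↦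
    lintegral_le_of_forall_le _ fun p ↦
      ENNReal.ofReal_le_ofReal (hle' _ _ (recency_extend_le M hi))
  rw [lintegral_roundKernel' _ _ _ _ _ hm]
  rcases Nat.eq_zero_or_pos (recency M h) with h0 | h0
  · obtain ⟨hMt, hs⟩ := le_and_notMem_of_recency_eq_zero h0
    simp only [h0, zero_tsub, pow_zero, mul_one] at hcomp
    have hlo : 0 ≤ b ^ M * (1 - x / 2) ∨ incompleteArms h = ∅ := hx1.imp
      (fun hx1 ↦ mul_nonneg (by positivity) (by linarith)) id
    rcases hlo with hlo | hemp
    · refine (lintegral_le_of_le_on (π.next t h) (Set.toFinite _).measurableSet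
        (by positivity) (mul_le_mul_of_nonneg_left (mul_le_of_le_one_right hb0.le hbx) hK0)
        (hπ hMt hs) hinc hcomp).trans (ENNReal.ofReal_le_ofReal ?_)
      rw [hU, h0, pow_zero, mul_one]
      calc _ = K * (b * (c * (b ^ M * (1 - x / 2)) + (1 - c))) := by ring
        _ ≤ K := mul_le_of_le_one_right hK0 hbc
    · exfalso
      refine hh fun j i ↦ Nat.pos_of_ne_zero fun hji ↦ ?_
      exact Set.notMem_empty i (hemp ▸ ⟨j, hji⟩)
  · have e : K * b ^ recency M h = K * (b * b ^ (recency M h - 1)) := by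
      rw [← pow_succ', Nat.sub_add_cancel h0]
    rw [hU, e]
    refine lintegral_le_of_forall_le _ fun i ↦ ?_
    by_cases hi : i ∈ incompleteArms h
    · refine (hinc i hi).trans (ENNReal.ofReal_le_ofReal ?_)
      have : b ^ M * (1 - x / 2) ≤ b ^ (recency M h - 1) := hbx.trans (one_le_pow₀ hb)
      gcongr
    · exact hcomp i hi

/-- The three bounds are strict at b = 1 and continuous in b, so they survive slightly to the right
of 1. -/
lemma exists_growth_rate (M : ℕ) {c x : ℝ} (hc : 0 < c) (hx : 0 < x) (hn : 0 < n) :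
    ∃ b : ℝ, 1 < b ∧ b * (1 - 1 / (2 * n)) ≤ 1 ∧ b ^ M * (1 - x / 2) ≤ 1 ∧
      b * (c * (b ^ M * (1 - x / 2)) + (1 - c)) ≤ 1 := by
  have hn' : (0 : ℝ) < n := by exact_mod_cast hn
  have h1 : ∀ᶠ b : ℝ in 𝓝 1, b * (1 - 1 / (2 * (n : ℝ))) < 1 :=
    (Continuous.tendsto (f := fun b : ℝ ↦ b * (1 - 1 / (2 * (n : ℝ)))) (by fun_prop) _).eventually_lt_const (by
      have : 0 < 1 / (2 * (n : ℝ)) := by positivity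
      linarith)
  have h2 : ∀ᶠ b in 𝓝 (1 : ℝ), b ^ M * (1 - x / 2) < 1 :=
    (Continuous.tendsto (f := fun b : ℝ ↦ b ^ M * (1 - x / 2)) (by fun_prop) _).eventually_lt_const
      (by simp; linarith)
  have h3 : ∀ᶠ b in 𝓝 (1 : ℝ), b * (c * (b ^ M * (1 - x / 2)) + (1 - c)) < 1 :=
    (Continuous.tendsto (f := fun b : ℝ ↦ b * (c * (b ^ M * (1 - x / 2)) + (1 - c)))
      (by fun_prop) _).eventually_lt_const (by simp; nlinarith)
  have h4 : ∀ᶠ b in 𝓝[>] (1 : ℝ), 1 < b := eventually_mem_nhdsWithin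
  obtain ⟨b, ⟨⟨hb1, hb2⟩, hb3⟩, hb4⟩ :=
    (((h1.and h2).and h3).filter_mono nhdsWithin_le_nhds |>.and h4).exists
  exact ⟨b, hb4, hb1.le, hb2.le, hb3.le⟩

lemma exists_pos_le_prob (A : ContextMatrix n k) : ∃ x : ℝ, 0 < x ∧ ∀ j i, x ≤ A.prob j i := by
  have := ((Filter.eventually_all (ι := Fin k)).2 fun j ↦ (Filter.eventually_all (ι := Fin n)).2
    fun i ↦ (eventually_le_nhds (A.pos j i)).filter_mono nhdsWithin_le_nhds).and
    (eventually_mem_nhdsWithin (s := Set.Ioi (0 : ℝ)))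
  obtain ⟨x, hx, hx0⟩ := this.exists
  exact ⟨x, hx0, hx⟩

/-- After `t` rounds all arms have been pulled often, with high probability. -/
lemma exists_measure_armCount_lt_le [NeZero n] (A : ContextMatrix n k)
    (μ : Matrix (Fin k) (Fin n) ℝ) (π : SamplingRule n k) (hπ : IsNSTS A.prob π) :
    ∃ b C : ℝ, 1 < b ∧ ∀ L t₁ t : ℕ, (L : ℝ) ≤ √(t₁ : ℝ) - n / 2 →
      trajLaw A μ π {ω | ¬ (Initialized (trunc ω t) ∧ ∀ i, L ≤ armCount (trunc ω t) i)} ≤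
        ENNReal.ofReal (C * 2 ^ (n * L) / b ^ (t - t₁)) := by
  obtain ⟨M, c, hc0, hinit⟩ := hπ.init
  obtain ⟨x, hx, hxA⟩ := exists_pos_le_prob A
  -- The constant of `IsNSTS.init` may be `⊤`; capping it at 1 makes it a real number.
  set c' : ℝ := (min c 1).toReal with hc'
  have hctop : min c 1 ≠ ⊤ := ne_top_of_le_ne_top ENNReal.one_ne_top (min_le_right _ _)
  have hc'0 : 0 < c' := ENNReal.toReal_pos (lt_min hc0 one_pos).ne' hctop
  obtain ⟨b, hb, hbn, hbx, hbc⟩ := exists_growth_rate (n := n) M hc'0 hx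
    (Nat.pos_of_ne_zero (NeZero.ne n))
  refine ⟨b, 2 ^ (k * n) * b ^ M, hb, fun L t₁ t hL ↦ ?_⟩
  have hb0 : 0 < b := by linarith
  have hstep : ∀ t (h : History n k t),
      ∫⁻ r, ENNReal.ofReal (potential b M L t₁ (t + 1) (extend h r)) ∂roundKernel A μ π t h ≤
      ENNReal.ofReal (potential b M L t₁ t h) := fun t h ↦ by
    by_cases hh : Initialized h
    · exact lintegral_potential_le_of_initialized A μ π hπ hb.le hbn M hL hh
    · refine lintegral_potential_le_of_not_initialized A μ π hb.le hxA hbx hbc hh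
        (fun hM hs ↦ ?_) L t₁
      rw [hc', ENNReal.ofReal_toReal hctop]
      exact (min_le_left _ _).trans (hinit t h hh hM hs)
  have hV : ∀ t, Measurable fun h : History n k t ↦ ENNReal.ofReal (potential b M L t₁ t h) :=
    fun t ↦ (measurable_potential b M L t₁ t).ennreal_ofReal
  have key := lintegral_trunc_le A μ π hV hstep
    (c := ENNReal.ofReal (2 ^ (k * n) * b ^ M * 2 ^ (n * L))) (ENNReal.ofReal_le_ofReal (by
      refine (potential_le hb.le M L t₁ _).trans ?_
      rw [Nat.zero_sub, pow_zero, one_mul]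
      have h1 : (2 : ℝ) ^ missing (Fin.elim0 : History n k 0) ≤ 2 ^ (k * n) :=
        pow_le_pow_right₀ one_le_two (missing_le _)
      have h2 : b ^ recency M (Fin.elim0 : History n k 0) ≤ b ^ M :=
        pow_le_pow_right₀ hb.le (recency_le M _)
      gcongr)) t
  have hpos : (0 : ℝ) < b ^ (t - t₁) := by positivity
  have hm := (mul_meas_ge_le_lintegral (μ := trajLaw A μ π)
      ((hV t).comp (measurable_trunc t)) (ENNReal.ofReal (b ^ (t - t₁)))).trans key
  rw [ENNReal.ofReal_div_of_pos hpos]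
  refine le_trans (measure_mono ?_) ((ENNReal.le_div_iff_mul_le
    (Or.inl (by simpa using hpos)) (Or.inl ENNReal.ofReal_ne_top)).2 (by rwa [mul_comm] at hm))
  -- Off the desired event the second factor of the potential is at least 1, so the potential is at
  -- least b^(t - t₁) and Markov's inequality applies.
  intro ω hω
  refine ENNReal.ofReal_le_ofReal (le_mul_of_one_le_right hpos.le ?_)
  by_cases hh : Initialized (trunc ω t)
  · have hd : deficit L (trunc ω t) ≠ 0 := fun hd ↦ hω ⟨hh, deficit_eq_zero.1 hd⟩
    rw [if_pos hh, if_neg hd]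
    exact one_le_pow₀ one_le_two
  · rw [if_neg hh]
    exact one_le_mul_of_one_le_of_one_le (one_le_mul_of_one_le_of_one_le (one_le_pow₀ one_le_two)
      (one_le_pow₀ hb.le)) (one_le_pow₀ one_le_two)

/-! ### The optimization problem -/

/-- Cauchy-Schwarz: xy/(x + y) is the minimum of x a² + y b² over a + b = 1. This variational form
gives both the Lipschitz bound and the two-arm reduction of `glr`. -/
lemma mul_div_add_mul_sq_le {x y : ℝ} (hx : 0 ≤ x) (hy : 0 ≤ y) (a b : ℝ) :
    x * y / (x + y) * (a + b) ^ 2 ≤ x * a ^ 2 + y * b ^ 2 := by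
  rcases (add_nonneg hx hy).eq_or_lt with h | h
  · rw [← h, div_zero, zero_mul]; positivity
  · rw [div_mul_eq_mul_div, div_le_iff₀ h]
    nlinarith [sq_nonneg (x * a - y * b)]

lemma mul_div_add_le_left {x y : ℝ} (hx : 0 ≤ x) (hy : 0 ≤ y) : x * y / (x + y) ≤ x := by
  simpa using mul_div_add_mul_sq_le hx hy 1 0

/-- A minimum of linear forms with coefficients in [0, 1] is 1-Lipschitz for the ℓ¹ distance,
including at the origin, where the quotient is 0 by convention. -/
lemma mul_div_add_le_add_abs {x y x' y' : ℝ} (hx : 0 ≤ x) (hy : 0 ≤ y) (hx' : 0 ≤ x')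
    (hy' : 0 ≤ y') : x' * y' / (x' + y') ≤ x * y / (x + y) + (|x' - x| + |y' - y|) := by
  set a := y / (x + y) with ha
  have ha0 : 0 ≤ a := by positivity
  have ha1 : a ≤ 1 := div_le_one_of_le₀ (by linarith) (by linarith)
  have h1 : x * y / (x + y) = x * a ^ 2 + y * (1 - a) ^ 2 := by
    rcases (add_nonneg hx hy).eq_or_lt with h | h
    · have hx0 : x = 0 := by linarith
      have hy0 : y = 0 := by linarith
      simp [hx0, hy0]
    · rw [ha]; field_simp; ring
  have h2 := mul_div_add_mul_sq_le hx' hy' a (1 - a)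
  rw [add_sub_cancel, one_pow, mul_one] at h2
  rw [h1]
  have h3 : (x' - x) * a ^ 2 ≤ |x' - x| :=
    (mul_le_mul_of_nonneg_right (le_abs_self _) (sq_nonneg a)).trans
      (mul_le_of_le_one_right (abs_nonneg _) (by nlinarith))
  have h4 : (y' - y) * (1 - a) ^ 2 ≤ |y' - y| :=
    (mul_le_mul_of_nonneg_right (le_abs_self _) (sq_nonneg _)).trans
      (mul_le_of_le_one_right (abs_nonneg _) (by nlinarith))
  linarith

/-- Superadditivity with its exact defect, which vanishes only for proportional pairs; uniqueness of
the maximizer rests on this. -/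
lemma mul_div_add_add_le {x y x' y' : ℝ} (hx : 0 < x) (hy : 0 < y) (hx' : 0 < x') (hy' : 0 < y') :
    x * y / (x + y) + x' * y' / (x' + y') +
      (x * y' - x' * y) ^ 2 / ((x + y) * (x' + y') * (x + x' + (y + y'))) =
      (x + x') * (y + y') / (x + x' + (y + y')) := by
  have h1 : x + y ≠ 0 := by positivity
  have h2 : x' + y' ≠ 0 := by positivity
  have h3 : x + x' + (y + y') ≠ 0 := by positivity
  field_simp
  ring

/-- The objective for the arm `b` and the coefficients `c i`. -/
def minRate (b : Fin n) (c w : Fin n → ℝ) : ℝ :=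
  ⨅ i : {i : Fin n // i ≠ b}, c i * (w b * w i / (w b + w i))

lemma nonempty_ne (hn : 2 ≤ n) (b : Fin n) : Nonempty {i : Fin n // i ≠ b} := by
  have : Nontrivial (Fin n) := Fin.nontrivial_iff_two_le.2 hn
  obtain ⟨i, hi⟩ := exists_ne b
  exact ⟨i, hi⟩

lemma minRate_le (b : Fin n) (c w : Fin n → ℝ) {i : Fin n} (hi : i ≠ b) :
    minRate b c w ≤ c i * (w b * w i / (w b + w i)) :=
  ciInf_le (Set.finite_range _).bddBelow (⟨i, hi⟩ : {i : Fin n // i ≠ b})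

lemma lt_minRate (hn : 2 ≤ n) {b : Fin n} {c w : Fin n → ℝ} {v : ℝ}
    (h : ∀ i, i ≠ b → v < c i * (w b * w i / (w b + w i))) : v < minRate b c w := by
  have := nonempty_ne hn b
  obtain ⟨i, hi⟩ := exists_eq_ciInf_of_finite
    (f := fun i : {i : Fin n // i ≠ b} ↦ c i * (w b * w i / (w b + w i)))
  rw [minRate, ← hi]
  exact h i i.2

lemma continuousOn_minRate (hn : 2 ≤ n) (b : Fin n) (c : Fin n → ℝ) :
    ContinuousOn (minRate b c) (stdSimplex ℝ (Fin n)) := by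
  have := nonempty_ne hn b
  have hterm : ∀ i, ContinuousOn (fun w : Fin n → ℝ ↦ w b * w i / (w b + w i))
      (stdSimplex ℝ (Fin n)) := fun i ↦ by
    refine LipschitzOnWith.continuousOn (K := 2) (LipschitzOnWith.of_dist_le_mul fun w hw w' hw' ↦ ?_)
    have h1 := mul_div_add_le_add_abs (hw.1 b) (hw.1 i) (hw'.1 b) (hw'.1 i)
    have h2 := mul_div_add_le_add_abs (hw'.1 b) (hw'.1 i) (hw.1 b) (hw.1 i)
    have h3 : |w b - w' b| ≤ dist w w' := dist_le_pi_dist w w' b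
    have h4 : |w i - w' i| ≤ dist w w' := dist_le_pi_dist w w' i
    rw [abs_sub_comm (w' b), abs_sub_comm (w' i)] at h1
    rw [Real.dist_eq, abs_le]
    push_cast
    constructor <;> linarith
  have e : minRate b c = fun w ↦ Finset.univ.inf' Finset.univ_nonempty
      fun i : {i : Fin n // i ≠ b} ↦ c i * (w b * w i / (w b + w i)) := by
    funext w
    rw [Finset.inf'_univ_eq_ciInf]
    rfl
  rw [e]
  exact ContinuousOn.finset_inf'_apply Finset.univ_nonempty
    fun i _ ↦ continuousOn_const.mul (hterm i)

lemma exists_isMaxOn_minRate (hn : 2 ≤ n) (b : Fin n) (c : Fin n → ℝ) :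
    ∃ w ∈ stdSimplex ℝ (Fin n), IsMaxOn (minRate b c) (stdSimplex ℝ (Fin n)) w :=
  (isCompact_stdSimplex ℝ (Fin n)).exists_isMaxOn ⟨_, single_mem_stdSimplex ℝ b⟩
    (continuousOn_minRate hn b c)

lemma minRate_pos_of_isMaxOn (hn : 2 ≤ n) {b : Fin n} {c : Fin n → ℝ} (hc : ∀ i, i ≠ b → 0 < c i)
    {w : Fin n → ℝ} (hw : IsMaxOn (minRate b c) (stdSimplex ℝ (Fin n)) w) :
    0 < minRate b c w := by
  have hn0 : (0 : ℝ) < n := by exact_mod_cast (by omega : 0 < n)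
  have hu : (fun _ ↦ 1 / n : Fin n → ℝ) ∈ stdSimplex ℝ (Fin n) := by
    refine ⟨fun _ ↦ by positivity, ?_⟩
    simp [hn0.ne']
  refine lt_of_lt_of_le (lt_minRate hn fun i hi ↦ ?_) (hw hu)
  exact mul_pos (hc i hi) (by positivity)

lemma weight_pos_of_minRate_pos (hn : 2 ≤ n) {b : Fin n} {c w : Fin n → ℝ}
    (hw : w ∈ stdSimplex ℝ (Fin n)) (h : 0 < minRate b c w) (i : Fin n) : 0 < w i := by
  have key : ∀ i, i ≠ b → w b ≠ 0 ∧ w i ≠ 0 := fun i hi ↦ by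
    have h1 := h.trans_le (minRate_le b c w hi)
    constructor <;> intro h0 <;> simp [h0] at h1
  refine (hw.1 i).lt_of_ne' ?_
  by_cases hi : i = b
  · obtain ⟨⟨i', hi'⟩⟩ := nonempty_ne hn b
    exact hi ▸ (key i' hi').1
  · exact (key i hi).2

/-- At an optimal weight vector all the constraints are tight. -/
lemma minRate_eq_of_isMaxOn (hn : 2 ≤ n) {b : Fin n} {c : Fin n → ℝ} (hc : ∀ i, i ≠ b → 0 < c i)
    {w : Fin n → ℝ} (hws : w ∈ stdSimplex ℝ (Fin n))
    (hw : IsMaxOn (minRate b c) (stdSimplex ℝ (Fin n)) w) {i₀ : Fin n} (hi₀ : i₀ ≠ b) :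
    c i₀ * (w b * w i₀ / (w b + w i₀)) = minRate b c w := by
  by_contra hne
  have hlt : minRate b c w < c i₀ * (w b * w i₀ / (w b + w i₀)) :=
    lt_of_le_of_ne (minRate_le b c w hi₀) (Ne.symm hne)
  have hV := minRate_pos_of_isMaxOn hn hc hw
  have hpos := weight_pos_of_minRate_pos hn hws hV
  -- Scale all other weights by 1 + ε and take the mass from `i₀`. By homogeneity the other
  -- constraints grow by 1 + ε, while the slack at `i₀` survives for small ε, contradicting
  -- maximality.
  set y : ℝ → ℝ := fun ε ↦ w i₀ - ε * (1 - w i₀) with hy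
  have hden : (1 + (0 : ℝ)) * w b + y 0 ≠ 0 := by
    have := hpos b
    have := hpos i₀
    simp only [hy, zero_mul, sub_zero, add_zero, one_mul]
    positivity
  have h1 : ∀ᶠ ε in 𝓝 (0 : ℝ), minRate b c w <
      c i₀ * ((1 + ε) * w b * y ε / ((1 + ε) * w b + y ε)) := by
    have hc : ContinuousAt (fun ε : ℝ ↦
        c i₀ * ((1 + ε) * w b * y ε / ((1 + ε) * w b + y ε))) 0 := by
      refine ContinuousAt.mul (by fun_prop) (ContinuousAt.div (by fun_prop) (by fun_prop) hden)
    refine hc.eventually_const_lt ?_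
    simpa [hy] using hlt
  have h2 : ∀ᶠ ε in 𝓝 (0 : ℝ), 0 < y ε := by
    have hc : ContinuousAt y 0 := by fun_prop
    exact hc.eventually_const_lt (by simpa [hy] using hpos i₀)
  have h3 : ∀ᶠ ε in 𝓝[>] (0 : ℝ), 0 < ε := eventually_mem_nhdsWithin
  obtain ⟨ε, ⟨h1, h2⟩, h3⟩ := (((h1.and h2).filter_mono nhdsWithin_le_nhds).and h3).exists
  set w' : Fin n → ℝ := Function.update (fun i ↦ (1 + ε) * w i) i₀ (y ε) with hw'
  have hb : w' b = (1 + ε) * w b := Function.update_of_ne hi₀.symm _ _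
  have hi : w' i₀ = y ε := Function.update_self _ _ _
  have hw's : w' ∈ stdSimplex ℝ (Fin n) := by
    refine ⟨fun i ↦ ?_, ?_⟩
    · by_cases h : i = i₀
      · rw [h, hi]; exact h2.le
      · rw [hw', Function.update_of_ne h]
        have := hpos i
        positivity
    · rw [hw', Finset.sum_update_of_mem (Finset.mem_univ _), ← Finset.mul_sum,
        Finset.sdiff_singleton_eq_erase]
      have := hws.2
      rw [← Finset.sum_erase_add _ _ (Finset.mem_univ i₀)] at this
      have e : ∑ i ∈ Finset.univ.erase i₀, w i = 1 - w i₀ := by linarith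
      rw [e, hy]; ring
  refine (lt_minRate hn fun i hib ↦ ?_).not_ge (hw hw's)
  by_cases h : i = i₀
  · rw [h, hb, hi]; exact h1
  · rw [hb, hw', Function.update_of_ne h, show (1 + ε) * w b * ((1 + ε) * w i) /
      ((1 + ε) * w b + (1 + ε) * w i) = (1 + ε) * (w b * w i / (w b + w i)) by
        have := hpos b
        have := hpos i
        field_simp]
    have h5 := minRate_le b c w hib
    nlinarith

/-- By concavity the midpoint is a maximizer too. All constraints are tight at the three points, so
the concavity defect vanishes, the weights are proportional, and both sum to 1. -/
lemma eq_of_isMaxOn_minRate (hn : 2 ≤ n) {b : Fin n} {c : Fin n → ℝ} (hc : ∀ i, i ≠ b → 0 < c i)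
    {w w' : Fin n → ℝ} (hws : w ∈ stdSimplex ℝ (Fin n))
    (hw : IsMaxOn (minRate b c) (stdSimplex ℝ (Fin n)) w) (hws' : w' ∈ stdSimplex ℝ (Fin n))
    (hw' : IsMaxOn (minRate b c) (stdSimplex ℝ (Fin n)) w') : w = w' := by
  have hpos := weight_pos_of_minRate_pos hn hws (minRate_pos_of_isMaxOn hn hc hw)
  have hpos' := weight_pos_of_minRate_pos hn hws' (minRate_pos_of_isMaxOn hn hc hw')
  have hV : minRate b c w = minRate b c w' := le_antisymm (hw' hws) (hw hws')
  set m : Fin n → ℝ := fun i ↦ (w i + w' i) / 2 with hm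
  have hms : m ∈ stdSimplex ℝ (Fin n) := by
    refine ⟨fun i ↦ by have := hpos i; have := hpos' i; simp only [hm]; positivity, ?_⟩
    rw [hm, ← Finset.sum_div, Finset.sum_add_distrib, hws.2, hws'.2]
    norm_num
  have hmid : ∀ i, m b * m i / (m b + m i) = (w b * w i / (w b + w i) +
      w' b * w' i / (w' b + w' i) + (w b * w' i - w' b * w i) ^ 2 /
      ((w b + w i) * (w' b + w' i) * (w b + w' b + (w i + w' i)))) / 2 := fun i ↦ by
    rw [mul_div_add_add_le (hpos b) (hpos i) (hpos' b) (hpos' i)]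
    have := hpos b
    have := hpos i
    have := hpos' b
    have := hpos' i
    simp only [hm]
    field_simp
  have hrem : ∀ i, 0 ≤ (w b * w' i - w' b * w i) ^ 2 /
      ((w b + w i) * (w' b + w' i) * (w b + w' b + (w i + w' i))) := fun i ↦ by
    have := hpos b
    have := hpos i
    have := hpos' b
    have := hpos' i
    positivity
  have hmmax : IsMaxOn (minRate b c) (stdSimplex ℝ (Fin n)) m := fun v hv ↦ by
    refine le_trans (show _ ≤ minRate b c w from hw hv) (le_of_not_gt fun hlt ↦ ?_)
    have := nonempty_ne hn b
    obtain ⟨i, hi⟩ := exists_eq_ciInf_of_finite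
      (f := fun i : {i : Fin n // i ≠ b} ↦ c i * (m b * m i / (m b + m i)))
    have h1 := minRate_le b c w i.2
    have h2 := minRate_le b c w' i.2
    have h3 : minRate b c m = c i * (m b * m i / (m b + m i)) := hi.symm
    rw [hmid] at h3
    have h4 := mul_nonneg (hc i i.2).le (hrem i)
    rw [← hV] at h2
    rw [h3] at hlt
    nlinarith
  have hprop : ∀ i, w b * w' i = w' b * w i := fun i ↦ by
    by_cases hib : i = b
    · rw [hib, mul_comm]
    have h1 := minRate_eq_of_isMaxOn hn hc hws hw hib
    have h2 := minRate_eq_of_isMaxOn hn hc hws' hw' hib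
    have h3 := minRate_eq_of_isMaxOn hn hc hms hmmax hib
    have h4 : minRate b c m = minRate b c w := le_antisymm (hw hms) (hmmax hws)
    rw [hmid, h4, ← h1] at h3
    rw [← hV, ← h1] at h2
    have hci := (hc i hib).ne'
    have h2' := mul_left_cancel₀ hci h2
    have h3' := mul_left_cancel₀ hci h3
    rw [h2'] at h3'
    have h5 : (w b * w' i - w' b * w i) ^ 2 /
      ((w b + w i) * (w' b + w' i) * (w b + w' b + (w i + w' i))) = 0 := by linarith
    have hd : (w b + w i) * (w' b + w' i) * (w b + w' b + (w i + w' i)) ≠ 0 := by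
      have := hpos b
      have := hpos i
      have := hpos' b
      have := hpos' i
      positivity
    rw [div_eq_zero_iff, or_iff_left hd] at h5
    exact sub_eq_zero.1 (pow_eq_zero_iff two_ne_zero |>.1 h5)
  have hb : w b = w' b := by
    have h1 : ∑ i, w b * w' i = ∑ i, w' b * w i := Finset.sum_congr rfl fun i _ ↦ hprop i
    rwa [← Finset.mul_sum, ← Finset.mul_sum, hws.2, hws'.2, mul_one, mul_one] at h1
  funext i
  have := hprop i
  rw [← hb] at this
  exact (mul_left_cancel₀ (hpos b).ne' this).symm

/-! ### Continuity in μ of the best arm, the gaps and the optimal weights -/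

lemma IsBestArm.eq {A μ : Matrix (Fin k) (Fin n) ℝ} {i i' : Fin n} (h : IsBestArm A μ i) (h' : IsBestArm A μ i') : i = i' := by
  by_contra hne
  exact (h i' (Ne.symm hne)).not_gt (h' i hne)

lemma continuous_armMean (A : Matrix (Fin k) (Fin n) ℝ) (i : Fin n) :
    Continuous fun μ : Matrix (Fin k) (Fin n) ℝ ↦ armMean A μ i :=
  continuous_finsetSum _ fun j _ ↦ continuous_const.mul
    ((continuous_apply i).comp (continuous_apply j))

lemma isOpen_isBestArm (A : Matrix (Fin k) (Fin n) ℝ) (i : Fin n) :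
    IsOpen {μ : Matrix (Fin k) (Fin n) ℝ | IsBestArm A μ i} := by
  simp only [IsBestArm, Set.ofPred_forall]
  exact isOpen_iInter_of_finite fun i' ↦ isOpen_iInter_of_finite fun _ ↦
    isOpen_lt (continuous_armMean A i') (continuous_armMean A i)

lemma eventually_nhds_matrix {μ : Matrix (Fin k) (Fin n) ℝ} {p : Matrix (Fin k) (Fin n) ℝ → Prop}
    (h : ∀ᶠ μ' in 𝓝 μ, p μ') :
    ∃ η > 0, ∀ μ' : Matrix (Fin k) (Fin n) ℝ, (∀ j i, |μ' j i - μ j i| < η) → p μ' := by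
  obtain ⟨η, hη, hp⟩ :=
    (Metric.eventually_nhds_iff (α := Fin k → Fin n → ℝ) (x := μ) (p := p)).1 h
  refine ⟨η, hη, fun μ' hμ' ↦ hp (y := μ') ?_⟩
  exact (dist_pi_lt_iff hη).2 fun j ↦ (dist_pi_lt_iff hη).2 fun i ↦ hμ' j i

section Best

variable [NeZero n] {A μ : Matrix (Fin k) (Fin n) ℝ}

lemma IsBestArm.bestArm_eq {i : Fin n} (h : IsBestArm A μ i) : bestArm A μ = i :=
  (Classical.epsilon_spec (p := IsBestArm A μ) ⟨i, h⟩).eq h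

lemma isBestArm_bestArm (h : μ ∈ uniqueBest A) : IsBestArm A μ (bestArm A μ) :=
  Classical.epsilon_spec h

lemma gap_pos (h : μ ∈ uniqueBest A) {i : Fin n} (hi : i ≠ bestArm A μ) : 0 < gap A μ i :=
  sub_pos.2 (isBestArm_bestArm h i hi)

lemma objective_eq_minRate :
    objective A μ = minRate (bestArm A μ) fun i ↦ gap A μ i ^ 2 / 2 := rfl

lemma optWeights_spec (hn : 2 ≤ n) (A μ : Matrix (Fin k) (Fin n) ℝ) :
    optWeights A μ ∈ stdSimplex ℝ (Fin n) ∧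
      IsMaxOn (objective A μ) (stdSimplex ℝ (Fin n)) (optWeights A μ) :=
  Classical.epsilon_spec (p := fun w ↦
    w ∈ stdSimplex ℝ (Fin n) ∧ IsMaxOn (objective A μ) (stdSimplex ℝ (Fin n)) w)
    (exists_isMaxOn_minRate hn (bestArm A μ) fun i ↦ gap A μ i ^ 2 / 2)

lemma half_sq_gap_pos (hμ : μ ∈ uniqueBest A) {i : Fin n} (hi : i ≠ bestArm A μ) :
    0 < gap A μ i ^ 2 / 2 := by
  have := gap_pos hμ hi
  positivity

lemma objective_optWeights_pos (hn : 2 ≤ n) (hμ : μ ∈ uniqueBest A) :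
    0 < objective A μ (optWeights A μ) :=
  minRate_pos_of_isMaxOn hn (fun _ hi ↦ half_sq_gap_pos hμ hi) (optWeights_spec hn A μ).2

lemma optWeights_pos (hn : 2 ≤ n) (hμ : μ ∈ uniqueBest A) (i : Fin n) :
    0 < optWeights A μ i :=
  weight_pos_of_minRate_pos (b := bestArm A μ) (c := fun i ↦ gap A μ i ^ 2 / 2) hn
    (optWeights_spec hn A μ).1 (objective_optWeights_pos hn hμ) i

lemma charTime_eq (hn : 2 ≤ n) (A μ : Matrix (Fin k) (Fin n) ℝ) :
    charTime A μ = (objective A μ (optWeights A μ))⁻¹ := by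
  obtain ⟨h1, h2⟩ := optWeights_spec hn A μ
  rw [charTime]
  congr 1
  have : Nonempty (stdSimplex ℝ (Fin n)) := ⟨⟨_, h1⟩⟩
  refine le_antisymm (ciSup_le fun w ↦ h2 w.2) ?_
  exact le_ciSup (f := fun w : stdSimplex ℝ (Fin n) ↦ objective A μ w)
    ⟨_, Set.forall_mem_range.2 fun w ↦ h2 w.2⟩ ⟨_, h1⟩

lemma eventually_isBestArm (hμ : μ ∈ uniqueBest A) :
    ∀ᶠ μ' in 𝓝 μ, IsBestArm A μ' (bestArm A μ) :=
  (isOpen_isBestArm A _).mem_nhds (isBestArm_bestArm hμ)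

lemma tendsto_gap (hμ : μ ∈ uniqueBest A) (i : Fin n) :
    Tendsto (fun μ' ↦ gap A μ' i) (𝓝 μ) (𝓝 (gap A μ i)) := by
  refine Tendsto.congr' ?_ (((continuous_armMean A (bestArm A μ)).tendsto μ).sub
    ((continuous_armMean A i).tendsto μ))
  filter_upwards [eventually_isBestArm hμ] with μ' h
  rw [gap, h.bestArm_eq]

/-- The best arm is locally constant and w_b w_i / (w_b + w_i) ≤ 1 on the simplex, so a change of
the coefficients by ε moves the objective by at most ε, uniformly in w. -/
lemma eventually_abs_objective_sub_le (hn : 2 ≤ n) (hμ : μ ∈ uniqueBest A) {ε : ℝ} (hε : 0 < ε) :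
    ∀ᶠ μ' in 𝓝 μ, ∀ w ∈ stdSimplex ℝ (Fin n),
      objective A μ' w ≤ objective A μ w + ε ∧ objective A μ w ≤ objective A μ' w + ε := by
  have hgap : ∀ᶠ μ' in 𝓝 μ, ∀ i, |gap A μ' i ^ 2 / 2 - gap A μ i ^ 2 / 2| < ε :=
    eventually_all.2 fun i ↦ by
      have := Metric.tendsto_nhds.1 (((tendsto_gap hμ i).pow 2).div_const 2) ε hε
      simpa only [Real.dist_eq] using this
  have := nonempty_ne hn (bestArm A μ)
  have key : ∀ (c c' w : Fin n → ℝ), w ∈ stdSimplex ℝ (Fin n) → (∀ i, |c i - c' i| < ε) →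
      minRate (bestArm A μ) c w ≤ minRate (bestArm A μ) c' w + ε := fun c c' w hw hcc ↦ by
    obtain ⟨i, hi⟩ := exists_eq_ciInf_of_finite (f := fun i : {i : Fin n // i ≠ bestArm A μ} ↦
      c' i * (w (bestArm A μ) * w i / (w (bestArm A μ) + w i)))
    have h1 : minRate (bestArm A μ) c' w =
      c' i * (w (bestArm A μ) * w i / (w (bestArm A μ) + w i)) := hi.symm
    have h2 := minRate_le (bestArm A μ) c w i.2
    have h3 := mul_div_add_le_left (hw.1 (bestArm A μ)) (hw.1 i)
    have h4 : w (bestArm A μ) ≤ 1 := (mem_Icc_of_mem_stdSimplex hw _).2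
    have h5 : 0 ≤ w (bestArm A μ) * w i / (w (bestArm A μ) + w i) :=
      div_nonneg (mul_nonneg (hw.1 _) (hw.1 _)) (add_nonneg (hw.1 _) (hw.1 _))
    have h6 := (abs_lt.1 (hcc i)).2
    rw [h1]
    nlinarith
  filter_upwards [eventually_isBestArm hμ, hgap] with μ' h1 h2 w hw
  rw [objective_eq_minRate, objective_eq_minRate, h1.bestArm_eq]
  exact ⟨key _ _ w hw h2, key _ _ w hw fun i ↦ by rw [abs_sub_comm]; exact h2 i⟩

/-- The optimal weights are continuous on the set of matrices with a unique best arm. -/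
lemma tendsto_optWeights (hn : 2 ≤ n) (hμ : μ ∈ uniqueBest A) :
    Tendsto (optWeights A) (𝓝 μ) (𝓝 (optWeights A μ)) := by
  obtain ⟨hs, hmax⟩ := optWeights_spec hn A μ
  refine tendsto_nhds.2 fun U hU hwU ↦ ?_
  set K := stdSimplex ℝ (Fin n) \ U with hK
  have hKc : IsCompact K := (isCompact_stdSimplex ℝ (Fin n)).diff hU
  rcases K.eq_empty_or_nonempty with hemp | hne
  · refine Eventually.of_forall fun μ' ↦ ?_
    by_contra h
    exact (Set.eq_empty_iff_forall_notMem.1 hemp) _ ⟨(optWeights_spec hn A μ').1, h⟩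
  -- Uniqueness makes the best value outside `U` strictly smaller than the maximum; a perturbation
  -- below a third of that difference cannot move the maximizer out of `U`.
  obtain ⟨v, hv, hvmax⟩ := hKc.exists_isMaxOn hne
    ((continuousOn_minRate hn (bestArm A μ) fun i ↦ gap A μ i ^ 2 / 2).mono Set.sdiff_subset)
  have hlt : objective A μ v < objective A μ (optWeights A μ) := by
    refine lt_of_le_of_ne (hmax hv.1) fun heq ↦ hv.2 ?_
    have hvm : IsMaxOn (objective A μ) (stdSimplex ℝ (Fin n)) v := fun w hw ↦ by
      have := hmax hw
      simp only [Set.mem_ofPred_eq] at this ⊢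
      linarith
    rwa [eq_of_isMaxOn_minRate hn (fun _ hi ↦ half_sq_gap_pos hμ hi) hv.1 hvm hs hmax]
  filter_upwards [eventually_abs_objective_sub_le hn hμ
    (show 0 < (objective A μ (optWeights A μ) - objective A μ v) / 3 by linarith)] with μ' h
  by_contra hnot
  obtain ⟨hs', hmax'⟩ := optWeights_spec hn A μ'
  have h1 : objective A μ (optWeights A μ') ≤ objective A μ v := hvmax ⟨hs', hnot⟩
  have h2 := (h _ hs').1
  have h3 := (h _ hs).2
  have h4 : objective A μ' (optWeights A μ) ≤ objective A μ' (optWeights A μ') := hmax' hs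
  linarith

end Best

/-! ### Measurability of the statistics -/

lemma measurable_armCount {t : ℕ} (i : Fin n) :
    Measurable fun h : History n k t ↦ armCount h i :=
  measurable_of_eraseRewards fun _ ↦ rfl

lemma measurable_pairCount {t : ℕ} (j : Fin k) (i : Fin n) :
    Measurable fun h : History n k t ↦ pairCount h j i :=
  measurable_of_eraseRewards fun _ ↦ rfl

lemma measurableSet_initialized {t : ℕ} : MeasurableSet {h : History n k t | Initialized h} :=
  measurableSet_setOfPred.2 (measurable_of_eraseRewards fun _ ↦ rfl)

lemma measurable_empMean {t : ℕ} (j : Fin k) (i : Fin n) :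
    Measurable fun h : History n k t ↦ empMean h j i := by
  refine Measurable.div ?_ (measurable_from_top.comp (measurable_pairCount j i))
  simp_rw [Finset.sum_filter]
  refine Finset.measurable_sum _ fun s _ ↦ ?_
  have hs : Measurable fun h : History n k t ↦ h s := measurable_pi_apply s
  exact Measurable.ite (hs (measurable_fst_eq_and j i)) (by fun_prop) measurable_const

lemma measurable_armMean_empMean {t : ℕ} (A : Matrix (Fin k) (Fin n) ℝ) (i : Fin n) :
    Measurable fun h : History n k t ↦ armMean A (empMean h) i :=
  Finset.measurable_sum _ fun j _ ↦ (measurable_empMean j i).const_mul _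

/-! ### Tracking -/

lemma ae_trunc_prodMk_of_forall (A : ContextMatrix n k) (μ : Matrix (Fin k) (Fin n) ℝ)
    (π : SamplingRule n k) (t : ℕ) {B : Set (History n k t × Round n k)} (hB : MeasurableSet B)
    (hstep : ∀ h, ∀ᵐ r ∂roundKernel A μ π t h, (h, r) ∈ B) :
    ∀ᵐ ω ∂trajLaw A μ π, (trunc ω t, ω t) ∈ B := by
  have hm : Measurable fun h : History n k (t + 1) ↦
      ((fun s ↦ h s.castSucc : History n k t), h (Fin.last t)) :=
    (measurable_pi_lambda _ fun s ↦ measurable_pi_apply _).prodMk (measurable_pi_apply _)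
  refine ae_trunc_of_forall A μ π t (hm hB) fun h ↦ ?_
  filter_upwards [hstep h] with r hr
  simpa using hr

lemma ae_roundKernel_of_next_eq_one (A : ContextMatrix n k) (μ : Matrix (Fin k) (Fin n) ℝ)
    (π : SamplingRule n k) {t : ℕ} {h : History n k t} {S : Set (Fin n)}
    (hS : π.next t h S = 1) : ∀ᵐ r ∂roundKernel A μ π t h, r.1 ∈ S := by
  have h1 : ∀ᵐ i ∂π.next t h, i ∈ S :=
    (mem_ae_iff_prob_eq_one (Set.toFinite _).measurableSet).2 hS
  have h2 : (roundKernel A μ π t h).map Prod.fst = π.next t h := by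
    rw [← Kernel.map_apply _ measurable_fst, ← Kernel.fst_eq, roundKernel, Kernel.fst_compProd]
  rw [← h2] at h1
  exact ae_of_ae_map measurable_fst.aemeasurable h1

/-- The differences t w_i - N_i sum to 0, so the largest is nonnegative. A forced arm has at most √t
pulls. -/
lemma armCount_le_of_mem_dTracking [NeZero n] (hn : 2 ≤ n) {A : Matrix (Fin k) (Fin n) ℝ} {t : ℕ}
    {h : History n k t} {i : Fin n} (hi : i ∈ dTracking A h) :
    (armCount h i : ℝ) ≤ max (t * optWeights A (empMean h) i) √(t : ℝ) := by
  unfold dTracking at hi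
  split_ifs at hi
  · refine le_trans (hi.1.trans (max_le ?_ (Real.sqrt_nonneg _))) (le_max_right _ _)
    have : (0 : ℝ) ≤ n / 2 := by positivity
    linarith
  · refine le_trans ?_ (le_max_left _ _)
    by_contra! hlt
    have hsum : ∑ i', (t * optWeights A (empMean h) i' - armCount h i') < ∑ _i' : Fin n, (0 : ℝ) :=
      Finset.sum_lt_sum_of_nonempty ⟨i, Finset.mem_univ i⟩ fun i' _ ↦
        (hi i').trans_lt (by linarith)
    rw [Finset.sum_sub_distrib, ← Finset.mul_sum, (optWeights_spec hn A _).1.2, ← Nat.cast_sum,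
      sum_armCount] at hsum
    simp at hsum

/-- The sample is close to `μ`: all pairs have been observed and the empirical means are accurate. -/
def Accurate (μ : Matrix (Fin k) (Fin n) ℝ) (η : ℝ) {t : ℕ} (h : History n k t) : Prop :=
  Initialized h ∧ ∀ j i, |empMean h j i - μ j i| < η

lemma measurableSet_accurate (μ : Matrix (Fin k) (Fin n) ℝ) (η : ℝ) (t : ℕ) :
    MeasurableSet {h : History n k t | Accurate μ η h} := by
  refine measurableSet_initialized.inter ?_
  refine measurableSet_setOfPred.2 (Measurable.forall fun j ↦ Measurable.forall fun i ↦ ?_)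
  exact measurableSet_setOfPred.1 (measurableSet_lt
    (measurable_norm.comp ((measurable_empMean j i).sub_const _)) measurable_const)

lemma ae_armCount_le [NeZero n] (hn : 2 ≤ n) (A : ContextMatrix n k)
    (μ : Matrix (Fin k) (Fin n) ℝ) (π : SamplingRule n k) (hπ : IsNSTS A.prob π) {η : ℝ}
    {w : Fin n → ℝ} (hw : ∀ μ' : Matrix (Fin k) (Fin n) ℝ, (∀ j i, |μ' j i - μ j i| < η) →
      μ' ∈ uniqueBest A.prob ∧ ∀ i, optWeights A.prob μ' i ≤ w i) :
    ∀ᵐ ω ∂trajLaw A μ π, ∀ t, Accurate μ η (trunc ω t) →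
      (armCount (trunc ω t) (ω t).1 : ℝ) ≤ max (t * w (ω t).1) √(t : ℝ) := by
  refine ae_all_iff.2 fun t ↦ ?_
  -- Quantifying over the value `i` of the pulled arm turns a random index into a finite
  -- intersection of measurable sets.
  have hB : MeasurableSet {p : History n k t × Round n k | ∀ i, p.2.1 = i → Accurate μ η p.1 →
      (armCount p.1 i : ℝ) ≤ max (t * w i) √(t : ℝ)} := by
    refine measurableSet_setOfPred.2 (Measurable.forall fun i ↦ Measurable.imp ?_
      (Measurable.imp ?_ ?_))
    · exact measurableSet_setOfPred.1 (measurableSet_eq_fun measurable_snd.fst measurable_const)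
    · exact measurableSet_setOfPred.1 (measurable_fst (measurableSet_accurate μ η t))
    · exact measurableSet_setOfPred.1 (measurableSet_le (measurable_from_top.comp
        ((measurable_armCount i).comp measurable_fst)) measurable_const)
  have := ae_trunc_prodMk_of_forall A μ π t hB fun h ↦ ?_
  · filter_upwards [this] with ω hω using hω _ rfl
  · by_cases hacc : Accurate μ η h
    · obtain ⟨h1, h2⟩ := hw _ hacc.2
      filter_upwards [ae_roundKernel_of_next_eq_one A μ π (hπ.track t h hacc.1 h1)] with r hr i hi _
      subst hi
      refine (armCount_le_of_mem_dTracking hn hr).trans (max_le_max_right _ ?_)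
      exact mul_le_mul_of_nonneg_left (h2 _) (Nat.cast_nonneg _)
    · exact Eventually.of_forall fun r i _ h ↦ absurd h hacc

lemma armCount_trunc_succ (ω : ℕ → Round n k) (t : ℕ) (i : Fin n) :
    armCount (trunc ω (t + 1)) i = armCount (trunc ω t) i + if (ω t).1 = i then 1 else 0 := by
  rw [trunc_succ, armCount_extend]

/-- At time `S` the count is at most `S`; afterwards it grows only from a value below the quota,
overshooting by at most 1. -/
lemma armCount_le_of_tracking {ω : ℕ → Round n k} {w : Fin n → ℝ} (hw : ∀ i, 0 ≤ w i) {S T : ℕ}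
    (htrack : ∀ t, S ≤ t → t < T →
      (armCount (trunc ω t) (ω t).1 : ℝ) ≤ max (t * w (ω t).1) √(t : ℝ)) (i : Fin n) :
    ∀ t, S ≤ t → t ≤ T →
      (armCount (trunc ω t) i : ℝ) ≤ max (S : ℝ) (max (T * w i) √(T : ℝ) + 1) := by
  intro t hSt
  induction t, hSt using Nat.le_induction with
  | base =>
    intro _
    refine le_trans ?_ (le_max_left _ _)
    have := Finset.single_le_sum (f := fun i ↦ armCount (trunc ω S) i) (fun i _ ↦ Nat.zero_le _)
      (Finset.mem_univ i)
    rw [sum_armCount] at this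
    exact_mod_cast this
  | succ t hSt ih =>
    intro htT
    rw [armCount_trunc_succ]
    split_ifs with hi
    · refine le_trans ?_ (le_max_right _ _)
      push_cast
      have h1 := htrack t hSt htT
      rw [hi] at h1
      have htT' : (t : ℝ) ≤ T := by exact_mod_cast (by omega : t ≤ T)
      have h2 : max (t * w i) √(t : ℝ) ≤ max (T * w i) √(T : ℝ) :=
        max_le_max (mul_le_mul_of_nonneg_right htT' (hw i)) (Real.sqrt_le_sqrt htT')
      linarith
    · simpa using ih (by omega)

/-- The sampling proportions are close to the weights which are tracked. -/
lemma le_armCount_of_tracking {ω : ℕ → Round n k} {w : Fin n → ℝ} (hw : w ∈ stdSimplex ℝ (Fin n))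
    {ε : ℝ} (hε : 0 < ε) {S T : ℕ} (hST : S ≤ T) (hS : (S : ℝ) ≤ ε * T + 1)
    (hT : 1 ≤ ε * T) (hT' : √(T : ℝ) ≤ ε * T)
    (htrack : ∀ t, S ≤ t → t < T →
      (armCount (trunc ω t) (ω t).1 : ℝ) ≤ max (t * (w (ω t).1 + ε)) √(t : ℝ)) (i : Fin n) :
    T * (w i - 2 * n * ε) ≤ armCount (trunc ω T) i := by
  have hup : ∀ i, (armCount (trunc ω T) i : ℝ) ≤ T * (w i + 2 * ε) := fun i ↦ by
    refine (armCount_le_of_tracking (w := fun i ↦ w i + ε) (fun i ↦ add_nonneg (hw.1 i) hε.le)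
      htrack i T hST le_rfl).trans ?_
    have h0 : 0 ≤ T * w i := mul_nonneg (Nat.cast_nonneg _) (hw.1 i)
    refine max_le (by nlinarith) ?_
    exact add_le_of_le_sub_right (max_le (by nlinarith) (by nlinarith))
  have hsum : ∑ i', (armCount (trunc ω T) i' : ℝ) = T := by
    rw [← Nat.cast_sum, sum_armCount]
  -- The counts sum to `T`, so upper bounds for the other arms are a lower bound for `i`.
  have hle : ∑ i' ∈ Finset.univ.erase i, (armCount (trunc ω T) i' : ℝ) ≤
      ∑ i' ∈ Finset.univ.erase i, T * (w i' + 2 * ε) := Finset.sum_le_sum fun i' _ ↦ hup i'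
  have hws := hw.2
  rw [← Finset.add_sum_erase _ _ (Finset.mem_univ i)] at hsum hws
  rw [← Finset.mul_sum, Finset.sum_add_distrib, Finset.sum_const,
    Finset.card_erase_of_mem (Finset.mem_univ i), Finset.card_univ, Fintype.card_fin,
    nsmul_eq_mul] at hle
  have hn1 : ((n - 1 : ℕ) : ℝ) ≤ n := by exact_mod_cast Nat.sub_le n 1
  have h3 : (T : ℝ) * (((n - 1 : ℕ) : ℝ) * (2 * ε)) ≤ T * (n * (2 * ε)) := by gcongr
  have h4 : ∑ i' ∈ Finset.univ.erase i, w i' = 1 - w i := by linarith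
  rw [h4] at hle
  nlinarith

/-! ### The generalized likelihood ratio -/

/-- The variance of `d` under the context law of arm `i` is nonnegative. -/
lemma sq_sum_mul_le (A : ContextMatrix n k) (i : Fin n) (d : Fin k → ℝ) :
    (∑ j, A.prob j i * d j) ^ 2 ≤ ∑ j, A.prob j i * d j ^ 2 := by
  obtain ⟨m, hm⟩ : ∃ m, m = ∑ j, A.prob j i * d j := ⟨_, rfl⟩
  have h : 0 ≤ ∑ j, A.prob j i * (d j - m) ^ 2 :=
    Finset.sum_nonneg fun j _ ↦ mul_nonneg (A.pos j i).le (sq_nonneg _)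
  have e : ∑ j, A.prob j i * (d j - m) ^ 2 =
      ∑ j, A.prob j i * d j ^ 2 - 2 * m * (∑ j, A.prob j i * d j) + m ^ 2 * ∑ j, A.prob j i := by
    rw [Finset.mul_sum, Finset.mul_sum, ← Finset.sum_sub_distrib,
      ← Finset.sum_add_distrib]
    exact Finset.sum_congr rfl fun j _ ↦ by ring
  rw [e, A.sum_eq_one, ← hm] at h
  rw [← hm]
  nlinarith

lemma exists_isBestArm (A : ContextMatrix n k) (i : Fin n) :
    ∃ μ : Matrix (Fin k) (Fin n) ℝ, IsBestArm A.prob μ i := by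
  refine ⟨fun _ i' ↦ if i' = i then 1 else 0, fun i' hi' ↦ ?_⟩
  simp [armMean, hi', A.sum_eq_one]

/-- Keeps the infimum in `glr` from being the default value 0 of an empty real infimum. -/
lemma nonempty_alt [NeZero n] (hn : 2 ≤ n) (A : ContextMatrix n k)
    (μ : Matrix (Fin k) (Fin n) ℝ) : (alt A.prob μ).Nonempty := by
  obtain ⟨⟨i, hi⟩⟩ := nonempty_ne hn (bestArm A.prob μ)
  obtain ⟨μ', hμ'⟩ := exists_isBestArm A i
  exact ⟨μ', ⟨i, hμ'⟩, by rwa [hμ'.bestArm_eq]⟩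

/-- A lower bound on the generalized likelihood ratio statistic in terms of the objective. -/
lemma mul_objective_le_glr [NeZero n] (hn : 2 ≤ n) (A : ContextMatrix n k) {t : ℕ}
    {h : History n k t} (hh : empMean h ∈ uniqueBest A.prob) {w : Fin n → ℝ} (hw : ∀ i, 0 ≤ w i)
    {K : ℝ} (hK : 0 ≤ K) (hN : ∀ j i, K * A.prob j i * w i ≤ pairCount h j i) :
    K * objective A.prob (empMean h) w ≤ glr A.prob h := by
  have := (nonempty_alt hn A (empMean h)).to_subtype
  rw [glr, if_pos hh]
  refine le_ciInf fun ⟨μ', hμ', hne⟩ ↦ ?_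
  set a := bestArm A.prob (empMean h) with ha
  set b := bestArm A.prob μ' with hb
  have hterm : ∀ i, K * w i * (armMean A.prob (empMean h) i - armMean A.prob μ' i) ^ 2 / 2 ≤
      ∑ j, pairCount h j i * ((empMean h j i - μ' j i) ^ 2 / 2) := fun i ↦ by
    have h1 := sq_sum_mul_le A i fun j ↦ empMean h j i - μ' j i
    have h2 : armMean A.prob (empMean h) i - armMean A.prob μ' i =
        ∑ j, A.prob j i * (empMean h j i - μ' j i) := by
      simp only [armMean, mul_sub, Finset.sum_sub_distrib]
    rw [h2]
    calc _ ≤ K * w i * (∑ j, A.prob j i * (empMean h j i - μ' j i) ^ 2) / 2 := by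
          have := hw i
          gcongr
      _ = ∑ j, K * A.prob j i * w i * ((empMean h j i - μ' j i) ^ 2 / 2) := by
          rw [Finset.mul_sum, Finset.sum_div]
          exact Finset.sum_congr rfl fun j _ ↦ by ring
      _ ≤ _ := Finset.sum_le_sum fun j _ ↦ mul_le_mul_of_nonneg_right (hN j i) (by positivity)
  -- Only the empirical best arm `a` and the best arm `b` of the alternative matter; the other terms
  -- are nonnegative.
  have hsum : ∑ i ∈ ({a, b} : Finset (Fin n)),
      ∑ j, (pairCount h j i : ℝ) * ((empMean h j i - μ' j i) ^ 2 / 2) ≤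
      ∑ i, ∑ j, pairCount h j i * ((empMean h j i - μ' j i) ^ 2 / 2) :=
    Finset.sum_le_sum_of_subset_of_nonneg (Finset.subset_univ _) fun i _ _ ↦
      Finset.sum_nonneg fun j _ ↦ by positivity
  rw [Finset.sum_pair hne.symm] at hsum
  refine le_trans ?_ hsum
  refine le_trans ?_ (add_le_add (hterm a) (hterm b))
  have h1 : objective A.prob (empMean h) w ≤ _ :=
    minRate_le a (fun i ↦ gap A.prob (empMean h) i ^ 2 / 2) w hne
  have h2 := mul_div_add_mul_sq_le (hw a) (hw b)
    (armMean A.prob (empMean h) a - armMean A.prob μ' a)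
    (armMean A.prob μ' b - armMean A.prob (empMean h) b)
  -- As `b` beats `a` under the alternative, the drop of `a` and the rise of `b` together cover the
  -- empirical gap.
  have h3 : gap A.prob (empMean h) b ≤ armMean A.prob (empMean h) a - armMean A.prob μ' a +
      (armMean A.prob μ' b - armMean A.prob (empMean h) b) := by
    have := isBestArm_bestArm hμ' a hne.symm
    rw [gap]
    linarith
  have h4 := gap_pos hh hne
  have h5 : 0 ≤ w a * w b / (w a + w b) :=
    div_nonneg (mul_nonneg (hw a) (hw b)) (add_nonneg (hw a) (hw b))
  have h6 : gap A.prob (empMean h) b ^ 2 ≤ (armMean A.prob (empMean h) a - armMean A.prob μ' a +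
      (armMean A.prob μ' b - armMean A.prob (empMean h) b)) ^ 2 :=
    pow_le_pow_left₀ h4.le h3 2
  have h7 := mul_le_mul_of_nonneg_left h6 h5
  have h8 : objective A.prob (empMean h) w ≤
      (w a * (armMean A.prob (empMean h) a - armMean A.prob μ' a) ^ 2 +
      w b * (armMean A.prob μ' b - armMean A.prob (empMean h) b) ^ 2) / 2 := by
    refine h1.trans ?_
    linarith
  refine (mul_le_mul_of_nonneg_left h8 hK).trans (le_of_eq ?_)
  ring

/-! ### Measurability of the stopping time -/

lemma measurableSet_isBestArm_empMean {t : ℕ} (A : Matrix (Fin k) (Fin n) ℝ) (i : Fin n) :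
    MeasurableSet {h : History n k t | IsBestArm A (empMean h) i} := by
  refine measurableSet_setOfPred.2 (Measurable.forall fun i' ↦ Measurable.imp measurable_const ?_)
  exact measurableSet_setOfPred.1 (measurableSet_lt (measurable_armMean_empMean A i')
    (measurable_armMean_empMean A i))

lemma mem_alt_iff [NeZero n] {A μ μ' : Matrix (Fin k) (Fin n) ℝ} {i : Fin n}
    (h : IsBestArm A μ i) : μ' ∈ alt A μ ↔ ∃ b, b ≠ i ∧ IsBestArm A μ' b := by
  constructor
  · rintro ⟨h1, h2⟩
    exact ⟨_, h.bestArm_eq ▸ h2, isBestArm_bestArm h1⟩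
  · rintro ⟨b, h1, h2⟩
    exact ⟨⟨b, h2⟩, by rwa [h2.bestArm_eq, h.bestArm_eq]⟩

lemma isOpen_alt [NeZero n] {A μ : Matrix (Fin k) (Fin n) ℝ} {i : Fin n} (h : IsBestArm A μ i) :
    IsOpen (alt A μ) := by
  have e : alt A μ = ⋃ b, ⋃ (_ : b ≠ i), {μ' | IsBestArm A μ' b} := by
    ext μ'
    rw [mem_alt_iff h]
    simp
  rw [e]
  exact isOpen_iUnion fun b ↦ isOpen_iUnion fun _ ↦ isOpen_isBestArm A b

/-- The quantity whose infimum over the alternatives is the generalized likelihood ratio. -/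
def divergence {t : ℕ} (h : History n k t) (μ' : Matrix (Fin k) (Fin n) ℝ) : ℝ :=
  ∑ i, ∑ j, pairCount h j i * ((empMean h j i - μ' j i) ^ 2 / 2)

lemma divergence_nonneg {t : ℕ} (h : History n k t) (μ' : Matrix (Fin k) (Fin n) ℝ) :
    0 ≤ divergence h μ' :=
  Finset.sum_nonneg fun i _ ↦ Finset.sum_nonneg fun j _ ↦ by positivity

lemma continuous_divergence {t : ℕ} (h : History n k t) : Continuous (divergence h) := by
  refine continuous_finsetSum _ fun i _ ↦ continuous_finsetSum _ fun j _ ↦ ?_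
  have : Continuous fun μ' : Matrix (Fin k) (Fin n) ℝ ↦ μ' j i :=
    (continuous_apply i).comp (continuous_apply j)
  fun_prop

lemma measurable_divergence {t : ℕ} (μ' : Matrix (Fin k) (Fin n) ℝ) :
    Measurable fun h : History n k t ↦ divergence h μ' := by
  refine Finset.measurable_sum _ fun i _ ↦ Finset.measurable_sum _ fun j _ ↦ ?_
  exact (measurable_from_top.comp (measurable_pairCount j i)).mul
    ((((measurable_empMean j i).sub_const _).pow_const 2).div_const 2)

lemma exists_countable_dense_matrix :
    ∃ D : Set (Matrix (Fin k) (Fin n) ℝ), D.Countable ∧ Dense D :=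
  TopologicalSpace.exists_countable_dense (Fin k → Fin n → ℝ)

/-- The alternatives form an open set and the divergence is continuous, so an infimum below `v` is
witnessed in a fixed countable dense set. That open set depends on the history only through the
empirical best arm. -/
lemma measurable_glr [NeZero n] (hn : 2 ≤ n) (A : ContextMatrix n k) (t : ℕ) :
    Measurable fun h : History n k t ↦ glr A.prob h := by
  refine measurable_of_Iio fun v ↦ ?_
  obtain ⟨D, hDc, hDd⟩ := exists_countable_dense_matrix (n := n) (k := k)
  have hlt : ∀ (h : History n k t) (i : Fin n), IsBestArm A.prob (empMean h) i →
      (glr A.prob h < v ↔ ∃ μ' ∈ D, (∃ b, b ≠ i ∧ IsBestArm A.prob μ' b) ∧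
        divergence h μ' < v) := fun h i hi ↦ by
    have := (nonempty_alt hn A (empMean h)).to_subtype
    have hbdd : BddBelow (Set.range fun μ' : alt A.prob (empMean h) ↦
        divergence h (μ' : Matrix (Fin k) (Fin n) ℝ)) :=
      ⟨0, Set.forall_mem_range.2 fun _ ↦ divergence_nonneg h _⟩
    have e : glr A.prob h = ⨅ μ' : alt A.prob (empMean h),
        divergence h (μ' : Matrix (Fin k) (Fin n) ℝ) := by
      rw [glr, if_pos ⟨i, hi⟩]
      rfl
    rw [e, ciInf_lt_iff hbdd]
    constructor
    · rintro ⟨⟨μ', hμ'⟩, hv⟩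
      obtain ⟨q, hq, hqD⟩ := hDd.inter_open_nonempty (alt A.prob (empMean h) ∩ {q | divergence h q < v})
        ((isOpen_alt hi).inter (isOpen_lt (continuous_divergence h) continuous_const)) ⟨μ', hμ', hv⟩
      exact ⟨q, hqD, (mem_alt_iff hi).1 hq.1, hq.2⟩
    · rintro ⟨q, -, hq, hv⟩
      exact ⟨⟨q, (mem_alt_iff hi).2 hq⟩, hv⟩
  have hset : (fun h : History n k t ↦ glr A.prob h) ⁻¹' Set.Iio v =
      (⋃ i, {h | IsBestArm A.prob (empMean h) i} ∩ ⋃ μ' ∈ D,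
        {h | (∃ b, b ≠ i ∧ IsBestArm A.prob μ' b) ∧ divergence h μ' < v}) ∪
      ((⋃ i, {h | IsBestArm A.prob (empMean h) i})ᶜ ∩ {_h | 0 < v}) := by
    ext h
    by_cases hu : empMean h ∈ uniqueBest A.prob
    · obtain ⟨i, hi⟩ := hu
      have h1 := hlt h i hi
      simp only [Set.mem_preimage, Set.mem_Iio, h1, Set.mem_union, Set.mem_iUnion, Set.mem_inter_iff,
        Set.mem_compl_iff, Set.mem_ofPred_eq, exists_prop]
      constructor
      · exact fun h2 ↦ Or.inl ⟨i, hi, h2⟩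
      · rintro (⟨i', hi', h2⟩ | ⟨h2, -⟩)
        · rwa [hi.eq hi']
        · exact absurd ⟨i, hi⟩ h2
    · have h0 : glr A.prob h = 0 := by rw [glr, if_neg hu]
      have hu' : ∀ i, ¬ IsBestArm A.prob (empMean h) i := fun i hi ↦ hu ⟨i, hi⟩
      simp [h0, hu']
  rw [hset]
  refine (MeasurableSet.iUnion fun i ↦ (measurableSet_isBestArm_empMean A.prob i).inter
    (MeasurableSet.biUnion hDc fun μ' _ ↦ (MeasurableSet.const _).inter
      (measurableSet_lt (measurable_divergence μ') measurable_const))).union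
    ((MeasurableSet.iUnion fun i ↦ measurableSet_isBestArm_empMean A.prob i).compl.inter
      (MeasurableSet.const _))

/-- The stopping condition is met after the history `h`. -/
def Stops [NeZero n] (A : Matrix (Fin k) (Fin n) ℝ) (δ : ℝ) {t : ℕ} (h : History n k t) : Prop :=
  Initialized h ∧ threshold n k t δ < glr A h

lemma measurableSet_stops [NeZero n] (hn : 2 ≤ n) (A : ContextMatrix n k) (δ : ℝ) (t : ℕ) :
    MeasurableSet {h : History n k t | Stops A.prob δ h} :=
  measurableSet_initialized.inter (measurableSet_lt measurable_const (measurable_glr hn A t))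

lemma stopTime_le [NeZero n] {A : Matrix (Fin k) (Fin n) ℝ} {δ : ℝ} {ω : ℕ → Round n k} {t : ℕ}
    (h : Stops A δ (trunc ω t)) : stopTime A δ ω ≤ t :=
  iInf₂_le t h

lemma measurable_stopTime [NeZero n] (hn : 2 ≤ n) (A : ContextMatrix n k) (δ : ℝ) :
    Measurable fun ω : ℕ → Round n k ↦ (stopTime A.prob δ ω : ℝ≥0∞) := by
  simp only [stopTime, ENat.toENNReal_iInf]
  refine Measurable.iInf fun t ↦ ?_
  have hm : MeasurableSet {ω : ℕ → Round n k | Stops A.prob δ (trunc ω t)} :=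
    measurable_trunc t (measurableSet_stops hn A δ t)
  classical
  have e : (fun ω : ℕ → Round n k ↦
      ⨅ (_ : Initialized (trunc ω t) ∧ threshold n k t δ < glr A.prob (trunc ω t)),
        ((t : ℕ∞) : ℝ≥0∞)) =
      fun ω ↦ if Stops A.prob δ (trunc ω t) then ((t : ℕ∞) : ℝ≥0∞) else ⊤ := by
    funext ω
    by_cases h : Stops A.prob δ (trunc ω t)
    · rw [if_pos h]; exact iInf_pos h
    · rw [if_neg h]; exact iInf_neg h
  rw [e]
  exact Measurable.ite hm measurable_const measurable_const

/-- A bound on the expectation of a stopping time which occurs at time `T` with high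
probability for each large `T`. -/
lemma expectedStop_le [NeZero n] (hn : 2 ≤ n) (A : ContextMatrix n k)
    (μ : Matrix (Fin k) (Fin n) ℝ) (π : SamplingRule n k) {δ : ℝ} {N : ℕ} {q : ℕ → ℝ≥0∞}
    (h : ∀ T, N ≤ T → trajLaw A μ π {ω | ¬ Stops A.prob δ (trunc ω T)} ≤ q T) :
    expectedStop A μ π δ ≤ N + ∑' T, q T := by
  set G : ℕ → Set (ℕ → Round n k) := fun T ↦ {ω | N ≤ T ∧ ¬ Stops A.prob δ (trunc ω T)} with hG
  have hGm : ∀ T, MeasurableSet (G T) := fun T ↦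
    (MeasurableSet.const _).inter (measurable_trunc T (measurableSet_stops hn A δ T)).compl
  -- Every time from `N` up to the first success after `N` is a failure; without any success the sum
  -- is infinite.
  have hpt : ∀ ω, (stopTime A.prob δ ω : ℝ≥0∞) ≤ N + ∑' T, (G T).indicator 1 ω := fun ω ↦ by
    by_cases hex : ∃ T, N ≤ T ∧ Stops A.prob δ (trunc ω T)
    · classical
      set T := Nat.find hex with hT
      obtain ⟨hNT, hst⟩ := Nat.find_spec hex
      have h1 : (stopTime A.prob δ ω : ℝ≥0∞) ≤ (T : ℝ≥0∞) := by
        have := stopTime_le hst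
        have h2 := ENat.toENNReal_le.2 this
        simpa using h2
      refine h1.trans ?_
      have h3 : ∑ s ∈ Finset.Ico N T, (G s).indicator (1 : (ℕ → Round n k) → ℝ≥0∞) ω
          = (T - N : ℕ) := by
        rw [Finset.sum_congr rfl (g := fun _ ↦ (1 : ℝ≥0∞)) fun s hs ↦ ?_]
        · simp
        · obtain ⟨hs1, hs2⟩ := Finset.mem_Ico.1 hs
          exact Set.indicator_of_mem (s := G s)
            ⟨hs1, fun hst ↦ Nat.find_min hex hs2 ⟨hs1, hst⟩⟩ _
      calc (T : ℝ≥0∞) = N + (T - N : ℕ) := by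
            rw [← Nat.cast_add, Nat.add_sub_cancel' hNT]
        _ ≤ _ := by rw [← h3]; gcongr; exact ENNReal.sum_le_tsum _
    · push Not at hex
      have : ∑' T, (G T).indicator (1 : (ℕ → Round n k) → ℝ≥0∞) ω = ⊤ := by
        refine top_le_iff.1 ?_
        calc (⊤ : ℝ≥0∞) = ∑' _ : ℕ, (1 : ℝ≥0∞) := by
              rw [ENNReal.tsum_const_eq_top_of_ne_zero one_ne_zero]
          _ = ∑' T, (G (T + N)).indicator (1 : (ℕ → Round n k) → ℝ≥0∞) ω := by
              refine tsum_congr fun T ↦ ?_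
              rw [Set.indicator_of_mem (s := G (T + N))
                ⟨Nat.le_add_left _ _, hex _ (Nat.le_add_left _ _)⟩]
              rfl
          _ ≤ _ := ENNReal.tsum_comp_le_tsum_of_injective (add_left_injective N) _
      rw [this]
      simp
  calc expectedStop A μ π δ
      ≤ ∫⁻ ω, (N + ∑' T, (G T).indicator 1 ω) ∂trajLaw A μ π := lintegral_mono hpt
    _ = N + ∑' T, trajLaw A μ π (G T) := by
        rw [lintegral_add_left measurable_const, lintegral_const, measure_univ, mul_one,
          lintegral_tsum fun T ↦ (measurable_one.indicator (hGm T)).aemeasurable]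
        simp_rw [lintegral_indicator_one (hGm _)]
    _ ≤ _ := by
        gcongr with T
        by_cases hNT : N ≤ T
        · exact (measure_mono fun ω hω ↦ hω.2).trans (h T hNT)
        · have : G T = ∅ := Set.eq_empty_of_forall_notMem fun ω hω ↦ hNT hω.1
          simp [this]

/-! ### The good event -/

lemma eventually_mul_exp_neg_mul_sqrt_le (C : ℝ) {c : ℝ} (hc : 0 < c) :
    ∀ᶠ t : ℕ in atTop, C * Real.exp (-c * √(t : ℝ)) ≤ 1 / (t : ℝ) ^ 3 := by
  have h1 : Tendsto (fun t : ℕ ↦ √(t : ℝ)) atTop atTop :=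
    Real.tendsto_sqrt_atTop.comp tendsto_natCast_atTop_atTop
  have h2 := ((tendsto_rpow_mul_exp_neg_mul_atTop_nhds_zero 6 c hc).comp h1).const_mul C
  rw [mul_zero] at h2
  filter_upwards [h2.eventually_lt_const one_pos, eventually_gt_atTop 0] with t ht ht0
  have ht0' : (0 : ℝ) < t := by exact_mod_cast ht0
  rw [le_div_iff₀ (by positivity)]
  have e : √(t : ℝ) ^ (6 : ℝ) = (t : ℝ) ^ 3 := by
    rw [show (6 : ℝ) = ((6 : ℕ) : ℝ) by norm_num, Real.rpow_natCast,
      show (6 : ℕ) = 2 * 3 from rfl, pow_mul, Real.sq_sqrt ht0'.le]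
  simp only [Function.comp_apply, e] at ht
  linarith

/-- The sample is close to `μ` and all context frequencies are not much too small. -/
def Good (A : ContextMatrix n k) (μ : Matrix (Fin k) (Fin n) ℝ) (η ε : ℝ) {t : ℕ}
    (h : History n k t) : Prop :=
  Accurate μ η h ∧ ∀ j i, (A.prob j i - ε) * armCount h i ≤ pairCount h j i

/-- The failures are nested: `L` pulls of each arm make the frequencies reliable, these give at
least `y * L` observations of each pair, and that many make the means accurate. -/
lemma measure_not_good_le [NeZero n] (A : ContextMatrix n k) (μ : Matrix (Fin k) (Fin n) ℝ)
    (π : SamplingRule n k) {η ε y : ℝ} (hη : 0 < η) (hε : 0 < ε) (hε1 : ε ≤ 1)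
    (hy : 0 ≤ y) (hyA : ∀ j i, y ≤ A.prob j i - ε) (L t : ℕ) :
    trajLaw A μ π {ω | ¬ Good A μ η ε (trunc ω t)} ≤
      trajLaw A μ π {ω | ¬ (Initialized (trunc ω t) ∧ ∀ i, L ≤ armCount (trunc ω t) i)} +
      ENNReal.ofReal (k * n * Real.exp (-(ε ^ 2 / 4 * L))) +
      ENNReal.ofReal (k * n * 2 * Real.exp (-(η ^ 2 / 2 * (y * L)))) := by
  set E₁ : Set (ℕ → Round n k) :=
    {ω | ¬ (Initialized (trunc ω t) ∧ ∀ i, L ≤ armCount (trunc ω t) i)}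
  set E₂ : Fin k × Fin n → Set (ℕ → Round n k) := fun p ↦ {ω | (L : ℝ) ≤ armCount (trunc ω t) p.2 ∧
    (pairCount (trunc ω t) p.1 p.2 : ℝ) < (A.prob p.1 p.2 - ε) * armCount (trunc ω t) p.2}
  set E₃ : Fin k × Fin n → Set (ℕ → Round n k) := fun p ↦
    {ω | y * L ≤ pairCount (trunc ω t) p.1 p.2 ∧
      η ≤ |empMean (trunc ω t) p.1 p.2 - μ p.1 p.2|}
  have hsub : {ω : ℕ → Round n k | ¬ Good A μ η ε (trunc ω t)} ⊆
      E₁ ∪ (⋃ p, E₂ p) ∪ ⋃ p, E₃ p := by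
    intro ω hω
    by_contra hcon
    simp only [Set.mem_union, Set.mem_iUnion, not_or, not_exists] at hcon
    obtain ⟨⟨h1, h2⟩, h3⟩ := hcon
    obtain ⟨hinit, hL⟩ := not_not.1 h1
    have hL' : ∀ i, (L : ℝ) ≤ armCount (trunc ω t) i := fun i ↦ by exact_mod_cast hL i
    have hfreq : ∀ j i, (A.prob j i - ε) * armCount (trunc ω t) i ≤ pairCount (trunc ω t) j i :=
      fun j i ↦ le_of_not_gt fun hlt ↦ h2 (j, i) ⟨hL' i, hlt⟩
    refine hω ⟨⟨hinit, fun j i ↦ lt_of_not_ge fun hge ↦ h3 (j, i) ⟨?_, hge⟩⟩, hfreq⟩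
    refine le_trans ?_ (hfreq j i)
    exact mul_le_mul (hyA j i) (hL' i) (Nat.cast_nonneg _) (hy.trans (hyA j i))
  refine (measure_mono hsub).trans ((measure_union_le _ _).trans (add_le_add
    ((measure_union_le _ _).trans (add_le_add le_rfl ?_)) ?_))
  · refine (measure_iUnion_fintype_le _ _).trans ((Finset.sum_le_sum fun p _ ↦
      measure_pairCount_lt_le A μ π p.1 p.2 hε hε1 t L).trans (le_of_eq ?_))
    rw [Finset.sum_const, Finset.card_univ, Fintype.card_prod, Fintype.card_fin, Fintype.card_fin,
      nsmul_eq_mul, ENNReal.ofReal_mul (by positivity), ← Nat.cast_mul, ENNReal.ofReal_natCast]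
  · refine (measure_iUnion_fintype_le _ _).trans ((Finset.sum_le_sum fun p _ ↦
      measure_abs_empMean_sub_ge_le A μ π p.1 p.2 hη t (y * L)).trans (le_of_eq ?_))
    rw [Finset.sum_const, Finset.card_univ, Fintype.card_prod, Fintype.card_fin, Fintype.card_fin,
      nsmul_eq_mul, ENNReal.ofReal_mul (by positivity), ENNReal.ofReal_mul (by positivity),
      ← Nat.cast_mul, ENNReal.ofReal_natCast, mul_assoc, ENNReal.ofReal_ofNat]

/-- The cube leaves room for the later union over order T times. Every error term decays at least
like exp(-c√t). -/
lemma eventually_measure_not_good_le [NeZero n] (A : ContextMatrix n k)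
    (μ : Matrix (Fin k) (Fin n) ℝ) (π : SamplingRule n k) (hπ : IsNSTS A.prob π) {η ε y : ℝ}
    (hη : 0 < η) (hε : 0 < ε) (hε1 : ε ≤ 1) (hy : 0 < y) (hyA : ∀ j i, y ≤ A.prob j i - ε) :
    ∀ᶠ t : ℕ in atTop, trajLaw A μ π {ω | ¬ Good A μ η ε (trunc ω t)} ≤
      ENNReal.ofReal (3 * (1 / (t : ℝ) ^ 3)) := by
  obtain ⟨b, C, hb, hexp⟩ := exists_measure_armCount_lt_le A μ π hπ
  have hb0 : 0 < b := by linarith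
  set β := Real.log b with hβ
  have hβ0 : 0 < β := Real.log_pos hb
  have h1 : Tendsto (fun t : ℕ ↦ √(t : ℝ)) atTop atTop :=
    Real.tendsto_sqrt_atTop.comp tendsto_natCast_atTop_atTop
  filter_upwards [h1.eventually_ge_atTop (4 * n + 4), h1.eventually_ge_atTop ((n + 2) / β),
    eventually_mul_exp_neg_mul_sqrt_le |C| one_pos,
    eventually_mul_exp_neg_mul_sqrt_le (k * n * Real.exp (ε ^ 2 / 4))
      (show 0 < ε ^ 2 / 8 by positivity),
    eventually_mul_exp_neg_mul_sqrt_le (k * n * 2 * Real.exp (η ^ 2 / 2 * y))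
      (show 0 < η ^ 2 / 4 * y by positivity)] with t hs1 hs2 hA hB hD
  set s := √(t : ℝ) with hs
  have hs0 : 0 ≤ s := Real.sqrt_nonneg _
  have hst : s ^ 2 = t := Real.sq_sqrt (Nat.cast_nonneg _)
  -- With t₁ = t/2 the exploration level √(t/2) - n/2 exceeds √t/2 for large t, and the remaining
  -- t/2 rounds give decay b^(-t/2), which beats 2^(n L).
  set L := ⌊s / 2⌋₊ with hL
  have hLle : (L : ℝ) ≤ s / 2 := Nat.floor_le (by positivity)
  have hLge : s / 2 - 1 ≤ L := by
    have := Nat.lt_floor_add_one (s / 2)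
    linarith
  have ht1 : ((t : ℝ) - 1) / 2 ≤ (t / 2 : ℕ) := by
    have : t ≤ 2 * (t / 2) + 1 := by omega
    have : (t : ℝ) ≤ 2 * (t / 2 : ℕ) + 1 := by exact_mod_cast this
    linarith
  have hLt : (L : ℝ) ≤ √((t / 2 : ℕ) : ℝ) - n / 2 := by
    have : s / 2 + n / 2 ≤ √((t / 2 : ℕ) : ℝ) := by
      refine Real.le_sqrt_of_sq_le (le_trans ?_ ht1)
      have hn0 : (0 : ℝ) ≤ n := Nat.cast_nonneg _
      rw [← hst]
      nlinarith
    linarith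
  have hbound1 : trajLaw A μ π {ω | ¬ (Initialized (trunc ω t) ∧
      ∀ i, L ≤ armCount (trunc ω t) i)} ≤ ENNReal.ofReal (1 / (t : ℝ) ^ 3) := by
    refine (hexp L (t / 2) t hLt).trans (ENNReal.ofReal_le_ofReal (le_trans ?_ hA))
    have hpow : (2 : ℝ) ^ (n * L) ≤ Real.exp (n * L) := by
      rw [← Nat.cast_mul, ← Real.exp_one_pow]
      exact pow_le_pow_left₀ two_pos.le (by linarith [Real.add_one_le_exp 1]) _
    have hbpow : b ^ (t - t / 2) = Real.exp (β * ((t - t / 2 : ℕ) : ℝ)) := by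
      rw [mul_comm, Real.exp_nat_mul, hβ, Real.exp_log hb0]
    have hhalf : (t : ℝ) / 2 ≤ ((t - t / 2 : ℕ) : ℝ) := by
      have : t ≤ 2 * (t - t / 2) := by omega
      have : (t : ℝ) ≤ 2 * ((t - t / 2 : ℕ) : ℝ) := by exact_mod_cast this
      linarith
    calc C * 2 ^ (n * L) / b ^ (t - t / 2)
        ≤ |C| * Real.exp (n * L) / Real.exp (β * ((t - t / 2 : ℕ) : ℝ)) := by
          rw [hbpow]
          gcongr
          exact le_abs_self C
      _ = |C| * Real.exp (n * L - β * ((t - t / 2 : ℕ) : ℝ)) := by rw [mul_div_assoc, Real.exp_sub]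
      _ ≤ |C| * Real.exp (-1 * s) := by
          gcongr
          have h2 : (n : ℝ) * L ≤ n * (s / 2) := by gcongr
          have h3 : β * ((t : ℝ) / 2) ≤ β * ((t - t / 2 : ℕ) : ℝ) := by gcongr
          rw [div_le_iff₀ hβ0] at hs2
          rw [← hst] at h3
          nlinarith
  have hbound2 : k * n * Real.exp (-(ε ^ 2 / 4 * L)) ≤ 1 / (t : ℝ) ^ 3 := by
    refine le_trans ?_ hB
    rw [mul_assoc (k * n : ℝ), ← Real.exp_add]
    gcongr
    nlinarith [mul_le_mul_of_nonneg_left hLge (sq_nonneg ε)]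
  have hbound3 : k * n * 2 * Real.exp (-(η ^ 2 / 2 * (y * L))) ≤ 1 / (t : ℝ) ^ 3 := by
    refine le_trans ?_ hD
    rw [mul_assoc (k * n * 2 : ℝ), ← Real.exp_add]
    gcongr
    have : 0 ≤ η ^ 2 * y := by positivity
    nlinarith [mul_le_mul_of_nonneg_left hLge this]
  have hp : (0 : ℝ) ≤ 1 / (t : ℝ) ^ 3 := by positivity
  rw [show 3 * (1 / (t : ℝ) ^ 3) = 1 / (t : ℝ) ^ 3 + 1 / (t : ℝ) ^ 3 + 1 / (t : ℝ) ^ 3 by ring,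
    ENNReal.ofReal_add (by positivity) hp, ENNReal.ofReal_add hp hp]
  exact (measure_not_good_le A μ π hη hε hε1 hy.le hyA L t).trans (add_le_add (add_le_add hbound1
    (ENNReal.ofReal_le_ofReal hbound2)) (ENNReal.ofReal_le_ofReal hbound3))

/-- One factor ρ is lost for the pull proportions, one for the context frequencies and one for the
objective at the empirical means. -/
lemma le_glr_of_good [NeZero n] (hn : 2 ≤ n) {A : ContextMatrix n k}
    {μ : Matrix (Fin k) (Fin n) ℝ} {ρ ε η ε' v : ℝ} {w : Fin n → ℝ}
    (hw : w ∈ stdSimplex ℝ (Fin n)) (hρ : 0 < ρ) (hε : 0 < ε)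
    (hwε : ∀ i, 2 * n * ε ≤ (1 - ρ) * w i) (hA : ∀ j i, ρ * A.prob j i ≤ A.prob j i - ε')
    (hη : ∀ μ' : Matrix (Fin k) (Fin n) ℝ, (∀ j i, |μ' j i - μ j i| < η) →
      μ' ∈ uniqueBest A.prob ∧ ρ * v ≤ objective A.prob μ' w)
    {ω : ℕ → Round n k} {S T : ℕ} (hST : S ≤ T) (hS : (S : ℝ) ≤ ε * T + 1) (hT : 1 ≤ ε * T)
    (hT' : √(T : ℝ) ≤ ε * T) (hgood : ∀ t, S ≤ t → t ≤ T → Good A μ η ε' (trunc ω t))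
    (htrack : ∀ t, Accurate μ η (trunc ω t) →
      (armCount (trunc ω t) (ω t).1 : ℝ) ≤ max (t * (w (ω t).1 + ε)) √(t : ℝ)) :
    Initialized (trunc ω T) ∧ ρ ^ 3 * v * T ≤ glr A.prob (trunc ω T) := by
  obtain ⟨⟨hinit, hclose⟩, hfreq⟩ := hgood T hST le_rfl
  refine ⟨hinit, ?_⟩
  obtain ⟨hu, hobj⟩ := hη _ hclose
  have hcount := le_armCount_of_tracking hw hε hST hS hT hT'
    fun t h1 h2 ↦ htrack t (hgood t h1 h2.le).1
  have hK : (0 : ℝ) ≤ ρ ^ 2 * T := by positivity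
  have := mul_objective_le_glr hn A hu hw.1 hK fun j i ↦ ?_
  · nlinarith [mul_le_mul_of_nonneg_left hobj hK]
  · have h1 : T * (ρ * w i) ≤ armCount (trunc ω T) i := by
      refine le_trans (mul_le_mul_of_nonneg_left ?_ (Nat.cast_nonneg _)) (hcount i)
      linarith [hwε i]
    have h2 : 0 ≤ ρ * A.prob j i := mul_nonneg hρ.le (A.pos j i).le
    calc ρ ^ 2 * T * A.prob j i * w i = ρ * A.prob j i * (T * (ρ * w i)) := by ring
      _ ≤ ρ * A.prob j i * armCount (trunc ω T) i := mul_le_mul_of_nonneg_left h1 h2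
      _ ≤ (A.prob j i - ε') * armCount (trunc ω T) i :=
          mul_le_mul_of_nonneg_right (hA j i) (Nat.cast_nonneg _)
      _ ≤ _ := hfreq j i

/-- The generalized likelihood ratio grows at the optimal rate, except on events of summable
probabilities. -/
lemma exists_summable_measure_glr_lt_le [NeZero n] (hn : 2 ≤ n) (A : ContextMatrix n k)
    {μ : Matrix (Fin k) (Fin n) ℝ} (hμ : μ ∈ uniqueBest A.prob) (π : SamplingRule n k)
    (hπ : IsNSTS A.prob π) {ρ : ℝ} (hρ : 0 < ρ) (hρ1 : ρ < 1) :
    ∃ (N : ℕ) (q : ℕ → ℝ≥0∞), ∑' T, q T ≠ ⊤ ∧ ∀ T, N ≤ T →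
      trajLaw A μ π {ω | ¬ (Initialized (trunc ω T) ∧
        ρ ^ 3 * objective A.prob μ (optWeights A.prob μ) * T ≤ glr A.prob (trunc ω T))} ≤ q T := by
  set w := optWeights A.prob μ with hw
  set v := objective A.prob μ w with hv
  have hv0 : 0 < v := objective_optWeights_pos hn hμ
  have hws : w ∈ stdSimplex ℝ (Fin n) := (optWeights_spec hn A.prob μ).1
  obtain ⟨x, hx, hxA⟩ := exists_pos_le_prob A
  have hx1 : x ≤ 1 := by
    obtain ⟨j⟩ : Nonempty (Fin k) := by
      by_contra hemp
      rw [not_nonempty_iff] at hemp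
      simpa using A.sum_eq_one 0
    refine (hxA j 0).trans ?_
    rw [← A.sum_eq_one 0]
    exact Finset.single_le_sum (fun j _ ↦ (A.pos j 0).le) (Finset.mem_univ j)
  -- The tracking error 2nε is made at most the fraction 1 - ρ of each weight, possible because all
  -- optimal weights are positive.
  obtain ⟨ε, ⟨hεw, hε1⟩, hε⟩ : ∃ ε : ℝ, ((∀ i, 2 * n * ε ≤ (1 - ρ) * w i) ∧ ε ≤ 1) ∧ 0 < ε := by
    have h1 : ∀ᶠ ε : ℝ in 𝓝 0, ∀ i, 2 * n * ε < (1 - ρ) * w i := eventually_all.2 fun i ↦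
      (Continuous.tendsto (f := fun ε : ℝ ↦ 2 * n * ε) (by fun_prop) 0).eventually_lt_const (by
        rw [mul_zero]
        exact mul_pos (by linarith) (optWeights_pos hn hμ i))
    have h2 : ∀ᶠ ε : ℝ in 𝓝 0, ε < 1 := eventually_lt_nhds one_pos
    obtain ⟨ε, hε, hε0⟩ := (((h1.and h2).filter_mono nhdsWithin_le_nhds).and
      (eventually_mem_nhdsWithin (s := Set.Ioi (0 : ℝ)))).exists
    exact ⟨ε, ⟨fun i ↦ (hε.1 i).le, hε.2.le⟩, hε0⟩
  obtain ⟨η, hη, hclose⟩ := eventually_nhds_matrix (((eventually_isBestArm hμ).and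
    (eventually_abs_objective_sub_le hn hμ (show 0 < (1 - ρ) * v from mul_pos (by linarith) hv0))).and
    (eventually_all.2 fun i ↦ ((tendsto_pi_nhds.1 (tendsto_optWeights hn hμ) i).eventually_lt_const
      (show optWeights A.prob μ i < w i + ε by rw [← hw]; linarith))))
  set ε' := (1 - ρ) * x with hε'
  have hε'0 : 0 < ε' := mul_pos (by linarith) hx
  have hε'A : ∀ j i, ρ * A.prob j i ≤ A.prob j i - ε' := fun j i ↦ by
    have := mul_le_mul_of_nonneg_left (hxA j i) (sub_nonneg.2 hρ1.le)
    linarith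
  have hbad := eventually_measure_not_good_le A μ π hπ hη hε'0 (by nlinarith)
    (mul_pos hρ hx) fun j i ↦
      (mul_le_mul_of_nonneg_left (hxA j i) hρ.le).trans (hε'A j i)
  obtain ⟨t₀, ht₀⟩ := eventually_atTop.1 hbad
  have htrack := ae_armCount_le hn A μ π hπ (η := η) (w := fun i ↦ w i + ε) fun μ' hμ' ↦
    ⟨⟨_, (hclose μ' hμ').1.1⟩, fun i ↦ ((hclose μ' hμ').2 i).le⟩
  -- T ≥ t₀/ε puts the window [εT, T] beyond `t₀`; T ≥ 1/ε² gives √T ≤ εT. At most 2T window times,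
  -- each failing with probability at most 3/(εT)³, yield 6/(ε³T²).
  refine ⟨⌈max (t₀ / ε) (1 / ε ^ 2)⌉₊ + 1,
    fun T ↦ ENNReal.ofReal (6 / ε ^ 3 * (1 / (T : ℝ) ^ 2)), ?_, fun T hT ↦ ?_⟩
  · rw [← ENNReal.ofReal_tsum_of_nonneg (fun T ↦ by positivity)
      ((Real.summable_one_div_nat_pow.2 one_lt_two).mul_left _)]
    exact ENNReal.ofReal_ne_top
  · have hTmax : max (t₀ / ε) (1 / ε ^ 2) ≤ T :=
      (Nat.le_ceil _).trans (by exact_mod_cast (by omega : ⌈max (t₀ / ε) (1 / ε ^ 2)⌉₊ ≤ T))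
    have hT1 : (1 : ℝ) ≤ T := by exact_mod_cast (by omega : 1 ≤ T)
    have hTt₀ : t₀ ≤ ε * T := by
      have := (le_max_left _ _).trans hTmax
      rwa [div_le_iff₀ hε, mul_comm] at this
    have hTε : 1 ≤ ε ^ 2 * T := by
      have := (le_max_right _ _).trans hTmax
      rwa [div_le_iff₀ (by positivity), mul_comm] at this
    have hT' : √(T : ℝ) ≤ ε * T := by
      rw [Real.sqrt_le_left (by positivity)]
      nlinarith
    have hεT : 1 ≤ ε * T := by nlinarith
    set S := ⌈ε * T⌉₊ with hS
    have hSle : (S : ℝ) ≤ ε * T + 1 := (Nat.ceil_lt_add_one (by positivity)).le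
    have hSge : ε * T ≤ S := Nat.le_ceil _
    have hST : S ≤ T := Nat.ceil_le.2 (mul_le_of_le_one_left (by linarith) hε1)
    have hsub : {ω : ℕ → Round n k | ¬ (Initialized (trunc ω T) ∧
        ρ ^ 3 * v * T ≤ glr A.prob (trunc ω T))} ⊆
        (⋃ t ∈ Finset.Icc S T, {ω | ¬ Good A μ η ε' (trunc ω t)}) ∪
        {ω | ¬ ∀ t, Accurate μ η (trunc ω t) →
          (armCount (trunc ω t) (ω t).1 : ℝ) ≤ max (t * (w (ω t).1 + ε)) √(t : ℝ)} := by
      intro ω hω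
      by_contra hcon
      rw [Set.mem_union, not_or] at hcon
      obtain ⟨h1, h2⟩ := hcon
      refine hω (le_glr_of_good hn hws hρ hε hεw hε'A (fun μ' hμ' ↦ ⟨⟨_, (hclose μ' hμ').1.1⟩, ?_⟩)
        hST hSle hεT hT' (fun t hSt htT ↦ ?_) (not_not.1 h2))
      · have := ((hclose μ' hμ').1.2 w hws).2
        linarith
      · by_contra hg
        exact h1 (Set.mem_biUnion (Finset.mem_coe.2 (Finset.mem_Icc.2 ⟨hSt, htT⟩)) hg)
    have hnull : trajLaw A μ π {ω | ¬ ∀ t, Accurate μ η (trunc ω t) →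
          (armCount (trunc ω t) (ω t).1 : ℝ) ≤ max (t * (w (ω t).1 + ε)) √(t : ℝ)} = 0 :=
      ae_iff.1 htrack
    refine (measure_mono hsub).trans ((measure_union_le _ _).trans ?_)
    rw [hnull, add_zero]
    have hpos : 0 < ε * T := by linarith
    calc _ ≤ ∑ t ∈ Finset.Icc S T, trajLaw A μ π {ω | ¬ Good A μ η ε' (trunc ω t)} :=
          measure_biUnion_finset_le _ _
      _ ≤ ∑ t ∈ Finset.Icc S T, ENNReal.ofReal (3 * (1 / (ε * T) ^ 3)) := by
          refine Finset.sum_le_sum fun t ht ↦ ?_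
          have hSt : (S : ℝ) ≤ t := by exact_mod_cast (Finset.mem_Icc.1 ht).1
          have h1 : t₀ ≤ t := by exact_mod_cast hTt₀.trans (hSge.trans hSt)
          refine (ht₀ t h1).trans (ENNReal.ofReal_le_ofReal ?_)
          have h2 := hSge.trans hSt
          gcongr
      _ ≤ ENNReal.ofReal (6 / ε ^ 3 * (1 / (T : ℝ) ^ 2)) := by
          rw [Finset.sum_const, nsmul_eq_mul, Nat.card_Icc, ← ENNReal.ofReal_natCast,
            ← ENNReal.ofReal_mul (Nat.cast_nonneg _)]
          refine ENNReal.ofReal_le_ofReal ?_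
          have h1 : ((T + 1 - S : ℕ) : ℝ) ≤ 2 * T := by
            have : T + 1 - S ≤ 2 * T := by omega
            exact_mod_cast this
          calc _ ≤ 2 * T * (3 * (1 / (ε * T) ^ 3)) := by gcongr
            _ = _ := by field_simp; ring

/-! ### The threshold -/

/-- The zeta term and -ln(1 - l)/2 are nonnegative. The bound makes the set in `Cg` bounded below,
so that its `sInf` is at most each of its elements. -/
lemma neg_le_gFun {l : ℝ} (hl : l ∈ Set.Ioo (1 / 2 : ℝ) 1) : -(2 * Real.log 4) ≤ gFun l := by
  obtain ⟨h1, h2⟩ := hl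
  have hsum : Summable fun m : ℕ ↦ 1 / ((m : ℝ) + 1) ^ (2 * l) := by
    have := (summable_nat_add_iff 1).2 (Real.summable_one_div_nat_rpow.2 (show 1 < 2 * l by linarith))
    simpa using this
  have hone : (1 : ℝ) ≤ ∑' m : ℕ, 1 / ((m : ℝ) + 1) ^ (2 * l) := by
    have := hsum.le_tsum 0 fun m _ ↦ by positivity
    simpa using this
  have h3 := Real.log_nonneg hone
  have h4 : Real.log (1 - l) ≤ 0 := Real.log_nonpos (by linarith) (by linarith)
  have h5 : Real.log (4 * l) ≤ Real.log 4 := Real.log_le_log (by linarith) (by linarith)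
  have h6 : 0 ≤ Real.log 4 := Real.log_nonneg (by norm_num)
  have h7 : 2 * l * Real.log (4 * l) ≤ 2 * Real.log 4 := by nlinarith
  rw [gFun]
  linarith

lemma Cg_le (x : ℝ) {l : ℝ} (hl : l ∈ Set.Ioo (1 / 2 : ℝ) 1) : Cg x ≤ (gFun l + x) / l := by
  refine csInf_le ⟨-(2 * |x - 2 * Real.log 4|), ?_⟩ ⟨l, hl, rfl⟩
  rintro _ ⟨l', hl', rfl⟩
  have h0 : 0 < l' := by linarith [hl'.1]
  have h1 := neg_le_gFun hl'
  have h2 := neg_abs_le (x - 2 * Real.log 4)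
  have h3 := abs_nonneg (x - 2 * Real.log 4)
  show _ ≤ (gFun l' + x) / l'
  rw [le_div_iff₀ h0]
  nlinarith [hl'.1]

lemma eventually_log_log_le (k : ℕ) (hk : 0 < k) {η : ℝ} (hη : 0 < η) :
    ∀ᶠ t : ℕ in atTop, 4 * k * Real.log (4 + Real.log (t / (2 * k))) ≤ η * t + 12 * k := by
  have hk' : (1 : ℝ) ≤ k := by exact_mod_cast hk
  have h1 := (Real.isLittleO_log_id_atTop.comp_tendsto tendsto_natCast_atTop_atTop).bound
    (show 0 < η / (4 * k) by positivity)
  filter_upwards [h1, eventually_ge_atTop (2 * k)] with t ht htk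
  have ht2 : 2 * (k : ℝ) ≤ t := by exact_mod_cast htk
  have ht0 : (0 : ℝ) < t := by linarith
  have h2 : Real.log t ≤ η / (4 * k) * t := by
    simp only [Function.comp_apply, id, Real.norm_eq_abs, Nat.abs_cast] at ht
    exact (le_abs_self _).trans ht
  have h3 : 0 ≤ Real.log (t / (2 * k)) := Real.log_nonneg (by rw [le_div_iff₀ (by positivity)]; linarith)
  have h4 : Real.log (t / (2 * k)) ≤ Real.log t :=
    Real.log_le_log (by positivity) (div_le_self ht0.le (by linarith))
  have h5 := Real.log_le_sub_one_of_pos (show 0 < 4 + Real.log (t / (2 * k)) by linarith)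
  have h6 : Real.log (4 + Real.log (t / (2 * k))) ≤ 3 + η / (4 * k) * t := by linarith
  calc _ ≤ 4 * k * (3 + η / (4 * k) * t) := by gcongr
    _ = _ := by field_simp; ring

/-- Evaluating `Cg` at the single point l = 1/(1 + η) gives slope 1/l = 1 + η in ln(1/δ), with `gFun
l` going into the constant; l = 1 is excluded because g is infinite there. -/
lemma exists_threshold_le (hn : 2 ≤ n) (hk : 0 < k) {η : ℝ} (hη : 0 < η) (hη1 : η < 1) :
    ∃ (N : ℕ) (C : ℝ), ∀ t, N ≤ t → ∀ δ : ℝ, 0 < δ →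
      threshold n k t δ ≤ η * t + (1 + η) * Real.log (1 / δ) + C := by
  obtain ⟨N, hN⟩ := eventually_atTop.1 (eventually_log_log_le k hk hη)
  have hk' : (0 : ℝ) < k := by exact_mod_cast hk
  have hn' : (0 : ℝ) < n - 1 := by
    have : (2 : ℝ) ≤ n := by exact_mod_cast hn
    linarith
  set l : ℝ := 1 / (1 + η) with hl
  have hlm : l ∈ Set.Ioo (1 / 2 : ℝ) 1 := by
    constructor
    · exact one_div_lt_one_div_of_lt (by linarith) (by linarith)
    · rw [hl, div_lt_one (by linarith)]; linarith
  refine ⟨N, 12 * k + (1 + η) * (2 * k * gFun l + Real.log (n - 1)), fun t ht δ hδ ↦ ?_⟩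
  have h1 := hN t ht
  have h2 := mul_le_mul_of_nonneg_left (Cg_le (Real.log (((n : ℝ) - 1) / δ) / (2 * k)) hlm)
    (show (0 : ℝ) ≤ 2 * k by positivity)
  have h3 : Real.log (((n : ℝ) - 1) / δ) = Real.log (n - 1) + Real.log (1 / δ) := by
    rw [← Real.log_mul hn'.ne' (by positivity), mul_one_div]
  have h4 : 2 * (k : ℝ) * ((gFun l + Real.log (((n : ℝ) - 1) / δ) / (2 * k)) / l) =
      (1 + η) * (2 * k * gFun l + (Real.log (n - 1) + Real.log (1 / δ))) := by
    rw [h3, hl]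
    field_simp
  rw [threshold]
  linarith

/-! ### Asymptotic optimality -/

lemma tendsto_log_one_div : Tendsto (fun δ : ℝ ↦ Real.log (1 / δ)) (𝓝[>] 0) atTop := by
  simp_rw [one_div, Real.log_inv]
  exact tendsto_neg_atBot_atTop.comp Real.tendsto_log_nhdsGT_zero

lemma exists_slack {v r : ℝ} (hv : 0 < v) (hr : v⁻¹ < r) :
    ∃ η : ℝ, 0 < η ∧ η < 1 ∧ 0 < (1 - η) ^ 3 * v - η ∧ (1 + η) / ((1 - η) ^ 3 * v - η) < r := by
  have hc : ContinuousAt (fun η : ℝ ↦ (1 - η) ^ 3 * v - η) 0 := by fun_prop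
  have h1 : ∀ᶠ η : ℝ in 𝓝 0, 0 < (1 - η) ^ 3 * v - η := hc.eventually_const_lt (by simpa using hv)
  have h2 : ∀ᶠ η : ℝ in 𝓝 0, (1 + η) / ((1 - η) ^ 3 * v - η) < r := by
    have hc' : ContinuousAt (fun η : ℝ ↦ (1 + η) / ((1 - η) ^ 3 * v - η)) 0 :=
      ContinuousAt.div (by fun_prop) hc (by simpa using hv.ne')
    exact Tendsto.eventually_lt_const (by simpa using hr) hc'
  have h3 : ∀ᶠ η : ℝ in 𝓝 0, η < 1 := eventually_lt_nhds one_pos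
  obtain ⟨η, h, h0⟩ := (((h1.and (h2.and h3)).filter_mono nhdsWithin_le_nhds).and
    (eventually_mem_nhdsWithin (s := Set.Ioi (0 : ℝ)))).exists
  exact ⟨η, h0, h.2.2, h.1, h.2.1⟩

lemma ContextMatrix.pos_card [NeZero n] (A : ContextMatrix n k) : 0 < k := by
  refine Nat.pos_of_ne_zero fun h ↦ ?_
  subst h
  simpa using A.sum_eq_one 0

/-- For d = (1 - η)^3 v - η and T > ((1 + η) ln(1/δ) + |C|)/d, the growth (1 - η)^3 v T exceeds the
threshold. The slope (1 + η)/d is below r, so all δ-free terms, ∑ q included, are absorbed as δ → 0.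
-/
lemma eventually_expectedStop_le [NeZero n] (hn : 2 ≤ n) (A : ContextMatrix n k)
    {μ : Matrix (Fin k) (Fin n) ℝ} (hμ : μ ∈ uniqueBest A.prob) (π : SamplingRule n k)
    (hπ : IsNSTS A.prob π) {r : ℝ} (hr : charTime A.prob μ < r) :
    ∀ᶠ δ : ℝ in 𝓝[>] 0, expectedStop A μ π δ ≤ ENNReal.ofReal (r * Real.log (1 / δ)) := by
  rw [charTime_eq hn] at hr
  set v := objective A.prob μ (optWeights A.prob μ) with hv
  have hv0 : 0 < v := objective_optWeights_pos hn hμ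
  obtain ⟨η, hη, hη1, hd, hlt⟩ := exists_slack hv0 hr
  set d := (1 - η) ^ 3 * v - η with hd'
  obtain ⟨N₁, C, hthr⟩ := exists_threshold_le (n := n) hn A.pos_card hη hη1
  obtain ⟨N₂, q, hq, hglr⟩ := exists_summable_measure_glr_lt_le hn A hμ π hπ
    (show 0 < 1 - η by linarith) (show 1 - η < 1 by linarith)
  set Q := (∑' T, q T).toReal with hQ
  set a := (1 + η) / d with ha
  have hlin : ∀ᶠ x : ℝ in atTop, N₁ + N₂ + (|C| / d + 2 + Q) + a * x ≤ r * x := by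
    filter_upwards [eventually_ge_atTop ((N₁ + N₂ + (|C| / d + 2 + Q)) / (r - a))] with x hx
    rw [div_le_iff₀ (by linarith)] at hx
    linarith
  filter_upwards [tendsto_log_one_div.eventually hlin, tendsto_log_one_div.eventually_ge_atTop 0,
    eventually_mem_nhdsWithin] with δ h1 h2 hδ
  set x := Real.log (1 / δ) with hx
  set N₃ := ⌈((1 + η) * x + |C|) / d⌉₊ + 1 with hN₃
  have hst : ∀ T, N₁ + N₂ + N₃ ≤ T →
      trajLaw A μ π {ω | ¬ Stops A.prob δ (trunc ω T)} ≤ q T := fun T hT ↦ by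
    refine (measure_mono fun ω hω ↦ ?_).trans (hglr T (by omega))
    intro hcon
    refine hω ⟨hcon.1, lt_of_lt_of_le ?_ hcon.2⟩
    refine (hthr T (by omega) δ hδ).trans_lt ?_
    have h3 : ((1 + η) * x + |C|) / d < T := by
      refine (Nat.le_ceil _).trans_lt ?_
      exact_mod_cast (by omega : ⌈((1 + η) * x + |C|) / d⌉₊ < T)
    rw [div_lt_iff₀ hd] at h3
    have h4 := le_abs_self C
    rw [hd'] at h3
    linarith
  refine (expectedStop_le hn A μ π hst).trans ?_
  rw [← ENNReal.ofReal_toReal hq, ← ENNReal.ofReal_natCast,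
    ← ENNReal.ofReal_add (Nat.cast_nonneg _) ENNReal.toReal_nonneg]
  refine ENNReal.ofReal_le_ofReal (le_trans ?_ h1)
  have h5 : (N₃ : ℝ) ≤ ((1 + η) * x + |C|) / d + 2 := by
    have := (Nat.ceil_lt_add_one (show 0 ≤ ((1 + η) * x + |C|) / d by positivity)).le
    rw [hN₃]
    push_cast
    linarith
  have h6 : ((1 + η) * x + |C|) / d = a * x + |C| / d := by rw [ha]; ring
  push_cast
  linarith

/-- The divergence equals (1 - 2δ)(ln(1 - δ) + ln(1/δ)), which is equivalent to ln(1/δ). -/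
lemma eventually_mul_log_le_bernoulliKL {s : ℝ} (hs : s < 1) :
    ∀ᶠ δ : ℝ in 𝓝[>] 0, s * Real.log (1 / δ) ≤ bernoulliKL δ (1 - δ) := by
  have h1 : ∀ᶠ δ : ℝ in 𝓝[>] 0, δ < min (1 / 2) ((1 - s) / 4) :=
    (eventually_lt_nhds (by
      refine lt_min (by norm_num) ?_
      linarith)).filter_mono nhdsWithin_le_nhds
  filter_upwards [h1, eventually_mem_nhdsWithin,
    tendsto_log_one_div.eventually_ge_atTop (2 / (1 - s)),
    tendsto_log_one_div.eventually_ge_atTop 0] with δ hlt hδ hx hx0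
  have hδ0 : 0 < δ := hδ
  have hδ1 := hlt.trans_le (min_le_left _ _)
  have hδ2 := hlt.trans_le (min_le_right _ _)
  have e : bernoulliKL δ (1 - δ) = (1 - 2 * δ) * (Real.log (1 - δ) + Real.log (1 / δ)) := by
    rw [bernoulliKL, sub_sub_cancel, Real.log_div hδ0.ne' (by linarith),
      Real.log_div (by linarith) hδ0.ne', one_div, Real.log_inv]
    ring
  have hlog : -1 ≤ Real.log (1 - δ) := by
    have h2 : Real.log (1 / 2) ≤ Real.log (1 - δ) := Real.log_le_log (by norm_num) (by linarith)
    have h3 := Real.log_two_lt_d9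
    rw [one_div, Real.log_inv] at h2
    linarith
  set x := Real.log (1 / δ)
  rw [div_le_iff₀ (by linarith)] at hx
  rw [e]
  nlinarith [mul_le_mul_of_nonneg_left hlog (show 0 ≤ 1 - 2 * δ by linarith),
    mul_le_mul_of_nonneg_right hδ2.le hx0]

lemma limsup_le_ofReal_of_forall_gt {f : ℝ → ℝ≥0∞} {F : Filter ℝ} {a : ℝ}
    (h : ∀ r, a < r → ∀ᶠ x in F, f x ≤ ENNReal.ofReal r) : limsup f F ≤ ENNReal.ofReal a := by
  have hlim : Tendsto ENNReal.ofReal (𝓝[>] a) (𝓝 (ENNReal.ofReal a)) :=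
    (ENNReal.continuous_ofReal.tendsto a).mono_left nhdsWithin_le_nhds
  refine ge_of_tendsto hlim ?_
  filter_upwards [eventually_mem_nhdsWithin] with r hr
  exact limsup_le_of_le (h := h r hr)

lemma div_ofReal_le_ofReal {e : ℝ≥0∞} {r x : ℝ} (hr : 0 ≤ r)
    (h : e ≤ ENNReal.ofReal (r * x)) : e / ENNReal.ofReal x ≤ ENNReal.ofReal r := by
  rw [ENNReal.ofReal_mul hr] at h
  exact ENNReal.div_le_of_le_mul h

end PostActionBAI

end

/-! ### The main theorem -/

open PostActionBAI
theorem mainTheorem3 {n k : ℕ} [NeZero n] (hn : 2 ≤ n) (A : ContextMatrix n k)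
    (μ : Matrix (Fin k) (Fin n) ℝ) (hμ : μ ∈ uniqueBest A.prob)
    (π : SamplingRule n k) (hπ : IsNSTS A.prob π) :
    (∀ δ ∈ Set.Ioo (0 : ℝ) 1,
      Measurable fun ω : ℕ → Round n k ↦ (stopTime A.prob δ ω : ℝ≥0∞)) ∧
    limsup (fun δ : ℝ ↦ expectedStop A μ π δ / ENNReal.ofReal (Real.log (1 / δ))) (𝓝[>] 0)
      ≤ ENNReal.ofReal (charTime A.prob μ) ∧
    limsup (fun δ : ℝ ↦ expectedStop A μ π δ /
        ENNReal.ofReal (charTime A.prob μ * bernoulliKL δ (1 - δ))) (𝓝[>] 0) ≤ 1 := by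
  have hT : 0 < charTime A.prob μ := by
    rw [charTime_eq hn]
    exact inv_pos.2 (objective_optWeights_pos hn hμ)
  refine ⟨fun δ _ ↦ measurable_stopTime hn A δ, ?_, ?_⟩
  · refine limsup_le_ofReal_of_forall_gt fun r hr ↦ ?_
    filter_upwards [eventually_expectedStop_le hn A hμ π hπ hr] with δ hδ
    exact div_ofReal_le_ofReal (hT.trans hr).le hδ
  · rw [← ENNReal.ofReal_one]
    refine limsup_le_ofReal_of_forall_gt fun r hr ↦ ?_
    have hr0 : 0 < r := by linarith
    -- The slack r > 1 is shared: r * (1 + 1/r)/2 = (r + 1)/2 lies strictly between 1 and r, leaving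
    -- room for both asymptotic bounds.
    have hs : (1 + 1 / r) / 2 < 1 := by
      have : 1 / r < 1 := (div_lt_one hr0).2 hr
      linarith
    have hr' : charTime A.prob μ < charTime A.prob μ * ((r + 1) / 2) :=
      lt_mul_of_one_lt_right hT (by linarith)
    filter_upwards [eventually_expectedStop_le hn A hμ π hπ hr',
      eventually_mul_log_le_bernoulliKL hs] with δ h1 h2
    refine div_ofReal_le_ofReal hr0.le (h1.trans (ENNReal.ofReal_le_ofReal ?_))
    calc charTime A.prob μ * ((r + 1) / 2) * Real.log (1 / δ)
        = r * (charTime A.prob μ * ((1 + 1 / r) / 2 * Real.log (1 / δ))) := by field_simp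
      _ ≤ _ := by gcongr
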